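/- Let $p$ be a prime, $k\ge 3$ an integer, and $K$ a field of characteristic $p$. Define sets of words $\bar\Theta_n$ over the alphabet $\{1,\dots,k\}$ by $\bar\Theta_0=\{1,\dots,k\}$ and $\bar\Theta_{n+1}=\{ab\mid a,b\in\bar\Theta_n,\ a\neq b\}$ for $n\ge 0$, and let $\bar\Theta=\bigcup_{n\ge 0}\bar\Theta_n$ (the specie of wild flies on $k$ letters). Let $R=K[t_a\mid a\in\bar\Theta]/(t_a^p\mid a\in\bar\Theta)$ be the truncated polynomial ring, with partial derivations $\partial_a=\partial/\partial t_a$, and define derivations $v_a$ of $R$ recursively by $$v_a=\partial_a+t_a^{p-1}\sum_{b\in\bar\Theta_n,\ b\ne a}t_b^{p-1}v_{ab},\qquad a\in\bar\Theta_n,\ n\ge 0$$ (expanding the recursion gives an infinite sum, which is a well-defined derivation because only finitely many of its terms act nontrivially on a given $t_d$). Let $L=L(\bar\Theta)=\mathrm{Lie}_p(v_1,\dots,v_k)\subset\mathrm{Der}_K R$ be the restricted Lie algebra generated by $v_1,\dots,v_k$, that is, the smallest Lie subalgebra of $\mathrm{Der}_K R$ that contains $v_1,\dots,v_k$ and is closed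 under $D\mapsto D^p$. Let $$\gamma_L(n)=\dim_K\big\langle\, [v_{i_1},[v_{i_2},[\dots,v_{i_s}]]]^{p^j}\ \big|\ s\ge 1,\ j\ge 0,\ 1\le i_1,\dots,i_s\le k,\ s p^j\le n\,\big\rangle_K$$ be its growth function with respect to the generators $v_1,\dots,v_k$. Put $\lambda=\log_2\big(p-\tfrac12\big)$. Then there exist positive constants $C_3=C_3(p,k)$ and $C_4=C_4(p,k)$, depending only on $p$ and $k$, and an $n_0$ such that $$\exp\Big(C_3\frac{n}{(\ln n)^{\lambda}}\Big)\le\gamma_L(n)\le\exp\Big(C_4\frac{n}{(\ln n)^{\lambda}}\Big),\qquad n\ge n_0 .$$ -/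

import Mathlib

noncomputable section

/-! ## Restricted Lie algebras of derivations and their growth -/

/-- In characteristic `p` the `p`-th power (iterated composition) of a derivation obeys the
Leibniz rule. -/
theorem der_pow_leibniz (p : ℕ) [hp : Fact p.Prime] {K A : Type*} [Field K] [CharP K p]
    [CommRing A] [Algebra K A] (D : Derivation K A A) (x y : A) :
    ((D : A →ₗ[K] A) ^ p) (x * y) =
      x * ((D : A →ₗ[K] A) ^ p) y + y * ((D : A →ₗ[K] A) ^ p) x := by
  set d : Module.End K A := (D : A →ₗ[K] A) with hd
  set T₁ : Module.End K (TensorProduct K A A) := TensorProduct.map d LinearMap.id with h₁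
  set T₂ : Module.End K (TensorProduct K A A) := TensorProduct.map LinearMap.id d with h₂
  have hc : Commute T₁ T₂ := by
    apply TensorProduct.ext'
    intro a b
    simp [h₁, h₂]
  have hpow₁ : ∀ (n : ℕ) (a b : A), (T₁ ^ n) (a ⊗ₜ[K] b) = ((d ^ n) a) ⊗ₜ[K] b := by
    intro n
    induction n with
    | zero => intro a b; simp
    | succ n ih => intro a b; rw [pow_succ', pow_succ', Module.End.mul_apply, ih]; simp [h₁]
  have hpow₂ : ∀ (n : ℕ) (a b : A), (T₂ ^ n) (a ⊗ₜ[K] b) = a ⊗ₜ[K] ((d ^ n) b) := by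
    intro n
    induction n with
    | zero => intro a b; simp
    | succ n ih => intro a b; rw [pow_succ', pow_succ', Module.End.mul_apply, ih]; simp [h₂]
  have hmul : ∀ z, d (LinearMap.mul' K A z) = LinearMap.mul' K A ((T₁ + T₂) z) := by
    intro z
    induction z using TensorProduct.induction_on with
    | zero => simp
    | tmul a b => simp [h₁, h₂, hd, mul_comm, add_comm]
    | add a b ha hb => rw [map_add, map_add, ha, hb, map_add, map_add]
  have hmul' : ∀ (n : ℕ) z,
      (d ^ n) (LinearMap.mul' K A z) = LinearMap.mul' K A (((T₁ + T₂) ^ n) z) := by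
    intro n
    induction n with
    | zero => intro z; simp
    | succ n ih =>
      intro z
      rw [pow_succ', pow_succ', Module.End.mul_apply, Module.End.mul_apply, ih, hmul]
  have hzero : (p : Module.End K (TensorProduct K A A)) = 0 := by
    have h := map_natCast (algebraMap K (Module.End K (TensorProduct K A A))) p
    rw [CharP.cast_eq_zero, map_zero] at h
    exact h.symm
  have hfrob : (T₁ + T₂) ^ p = T₁ ^ p + T₂ ^ p := by
    rw [hc.add_pow_prime_eq hp.out, hzero]
    simp
  have := hmul' p (x ⊗ₜ[K] y)
  rw [hfrob, LinearMap.add_apply, hpow₁, hpow₂] at this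
  simp only [LinearMap.mul'_apply, map_add] at this
  rw [this]
  ring

/-- The `p`-mapping `D ↦ D^p` of the restricted Lie algebra `Der A` over a field of
characteristic `p`: the `p`-fold composition of the derivation `D` with itself. -/
def derPMap (p : ℕ) [Fact p.Prime] {K A : Type*} [Field K] [CharP K p]
    [CommRing A] [Algebra K A] (D : Derivation K A A) : Derivation K A A :=
  Derivation.mk' ((D : A →ₗ[K] A) ^ p) fun x y => by
    simpa only [smul_eq_mul] using der_pow_leibniz p D x y

/-- The `p`-mapping is literally the `p`-fold iterate. -/
theorem derPMap_apply (p : ℕ) [Fact p.Prime] {K A : Type*} [Field K] [CharP K p]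
    [CommRing A] [Algebra K A] (D : Derivation K A A) (x : A) : derPMap p D x = (⇑D)^[p] x := by
  change ((D : A →ₗ[K] A) ^ p) x = _
  rw [Module.End.pow_apply]
  rfl

/-- `Lie_p(X)`: the restricted subalgebra of `Der A` generated by `X`, i.e. the smallest Lie
subalgebra that contains `X` and is closed under the `p`-mapping. -/
def lieP (p : ℕ) [Fact p.Prime] {K A : Type*} [Field K] [CharP K p] [CommRing A] [Algebra K A]
    (X : Set (Derivation K A A)) : LieSubalgebra K (Derivation K A A) :=
  sInf {H | X ⊆ (H : Set (Derivation K A A)) ∧ ∀ D ∈ H, derPMap p D ∈ H}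

theorem subset_lieP (p : ℕ) [Fact p.Prime] {K A : Type*} [Field K] [CharP K p] [CommRing A]
    [Algebra K A] (X : Set (Derivation K A A)) {D : Derivation K A A} (hD : D ∈ X) :
    D ∈ lieP p X := by
  rw [lieP, ← SetLike.mem_coe, LieSubalgebra.coe_sInf, Set.mem_iInter₂]
  exact fun H hH => hH.1 hD

theorem pMap_mem_lieP (p : ℕ) [Fact p.Prime] {K A : Type*} [Field K] [CharP K p] [CommRing A]
    [Algebra K A] (X : Set (Derivation K A A)) {D : Derivation K A A} (hD : D ∈ lieP p X) :
    derPMap p D ∈ lieP p X := by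
  rw [lieP, ← SetLike.mem_coe, LieSubalgebra.coe_sInf, Set.mem_iInter₂] at hD ⊢
  exact fun H hH => hH.2 D (hD H hH)

/-- The `p`-mapping of the restricted Lie algebra `Lie_p(X)`. -/
def liePMap (p : ℕ) [Fact p.Prime] {K A : Type*} [Field K] [CharP K p] [CommRing A]
    [Algebra K A] (X : Set (Derivation K A A)) (x : lieP p X) : lieP p X :=
  ⟨derPMap p (x : Derivation K A A), pMap_mem_lieP p X x.2⟩

/-- The right-normed commutator `[x₁, [x₂, [..., xₛ]]]` of a list. -/
def rightNormed {L : Type*} [LieRing L] : List L → L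
  | [] => 0
  | [x] => x
  | x :: y :: l => ⁅x, rightNormed (y :: l)⁆

/-- For a Lie algebra `L` with a `p`-mapping `pm` and a set `X` of generators, the span of all
`[x_1, ..., x_s]^(p^j)` with `s ≥ 1`, `j ≥ 0`, `x_i ∈ X` and `s p^j ≤ n`. -/
def growthSpace (p : ℕ) (K : Type*) {L : Type*} [Field K] [LieRing L] [LieAlgebra K L]
    (pm : L → L) (X : Set L) (n : ℕ) : Submodule K L :=
  Submodule.span K {y | ∃ (l : List L) (j : ℕ), l ≠ [] ∧ (∀ x ∈ l, x ∈ X) ∧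
    l.length * p ^ j ≤ n ∧ y = pm^[j] (rightNormed l)}

/-- The growth function `γ_L(X, n)` of a restricted Lie algebra `L` with respect to a finite
generating set `X`. -/
def growthFunction (p : ℕ) (K : Type*) {L : Type*} [Field K] [LieRing L] [LieAlgebra K L]
    (pm : L → L) (X : Set L) (n : ℕ) : ℕ :=
  Module.finrank K (growthSpace p K pm X n)

/-! ## Truncated polynomial rings -/

/-- The truncated polynomial ring `K[t_a | a ∈ σ] / (t_a^p | a ∈ σ)`. -/
abbrev TruncPoly (p : ℕ) (K σ : Type*) [Field K] : Type _ :=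
  MvPolynomial σ K ⧸ Ideal.span (Set.range fun a : σ => (MvPolynomial.X a : MvPolynomial σ K) ^ p)

namespace TruncPoly

/-- The variable `t_a`. -/
def t (p : ℕ) (K : Type*) {σ : Type*} [Field K] (a : σ) : TruncPoly p K σ :=
  Ideal.Quotient.mk _ (MvPolynomial.X a)

theorem mkDerivation_vanish (p : ℕ) {K σ : Type*} [Field K] [CharP K p]
    (f : σ → TruncPoly p K σ) (q : MvPolynomial σ K)
    (hq : q ∈ Ideal.span (Set.range fun a : σ => (MvPolynomial.X a : MvPolynomial σ K) ^ p)) :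
    MvPolynomial.mkDerivation K f q = 0 := by
  have hp0 : (p : TruncPoly p K σ) = 0 := by
    have h := map_natCast (algebraMap K (TruncPoly p K σ)) p
    rw [CharP.cast_eq_zero, map_zero] at h
    exact h.symm
  induction hq using Submodule.span_induction with
  | mem x hx =>
    obtain ⟨a, rfl⟩ := hx
    simp only [Derivation.leibniz_pow]
    rw [nsmul_eq_mul, hp0, zero_mul]
  | zero => simp
  | add x y _ _ hx hy => rw [map_add, hx, hy, add_zero]
  | smul r x hx ih =>
    rw [smul_eq_mul, Derivation.leibniz, ih, smul_zero, zero_add, ← algebraMap_smul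
      (TruncPoly p K σ) x]
    have : algebraMap (MvPolynomial σ K) (TruncPoly p K σ) x = 0 :=
      Ideal.Quotient.eq_zero_iff_mem.mpr hx
    rw [this]
    exact zero_mul (MvPolynomial.mkDerivation K f r : TruncPoly p K σ)

/-- The derivation `∑_a f_a ∂/∂t_a` (a possibly infinite sum) of the truncated polynomial ring:
the unique `K`-derivation that maps `t_a` to `f_a` for each `a`. -/
def mkDer (p : ℕ) {K σ : Type*} [Field K] [CharP K p] (f : σ → TruncPoly p K σ) :
    Derivation K (TruncPoly p K σ) (TruncPoly p K σ) :=
  Derivation.mk'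
    ((Submodule.liftQ ((Ideal.span (Set.range fun a : σ =>
        (MvPolynomial.X a : MvPolynomial σ K) ^ p)).restrictScalars K)
      (MvPolynomial.mkDerivation K f : MvPolynomial σ K →ₗ[K] TruncPoly p K σ)
      (fun q hq => mkDerivation_vanish p f q hq) :) : TruncPoly p K σ →ₗ[K] TruncPoly p K σ)
    (fun x y => by
      obtain ⟨x, rfl⟩ := Ideal.Quotient.mk_surjective x
      obtain ⟨y, rfl⟩ := Ideal.Quotient.mk_surjective y
      exact (MvPolynomial.mkDerivation K f).leibniz x y)

theorem mkDer_t (p : ℕ) {K σ : Type*} [Field K] [CharP K p] (f : σ → TruncPoly p K σ) (a : σ) :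
    mkDer p f (t p K a) = f a :=
  MvPolynomial.mkDerivation_X K f a

theorem der_ext (p : ℕ) {K σ : Type*} [Field K]
    {D E : Derivation K (TruncPoly p K σ) (TruncPoly p K σ)}
    (h : ∀ a, D (t p K a) = E (t p K a)) : D = E := by
  ext x
  obtain ⟨x, rfl⟩ := Ideal.Quotient.mk_surjective x
  induction x using MvPolynomial.induction_on with
  | C c =>
    exact (D.map_algebraMap c).trans (E.map_algebraMap c).symm
  | add x y hx hy => rw [map_add, map_add, map_add, hx, hy]
  | mul_X x a hx =>
    rw [map_mul, Derivation.leibniz, Derivation.leibniz, hx]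
    rw [show (Ideal.Quotient.mk _ (MvPolynomial.X a) : TruncPoly p K σ) = t p K a from rfl, h a]

/-- The partial derivation `∂_a = ∂/∂t_a`. -/
def pd (p : ℕ) (K : Type*) {σ : Type*} [Field K] [CharP K p] [DecidableEq σ] (a : σ) :
    Derivation K (TruncPoly p K σ) (TruncPoly p K σ) :=
  mkDer p fun b => if b = a then 1 else 0

end TruncPoly

/-! ## Wild flies -/

/-- Generation `n` of the specie of wild flies on `k` letters. Generation `0` is the alphabet;
generation `n + 1` consists of all words `ab` with `a ≠ b` in generation `n`. All words of
generation `n` have the same length `2 ^ n`, so the word `ab` is the same thing as the ordered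
pair `(a, b)`. -/
def WildFly (k : ℕ) : ℕ → Type
  | 0 => Fin k
  | n + 1 => {ab : WildFly k n × WildFly k n // ab.1 ≠ ab.2}

instance WildFly.decEq (k : ℕ) : (n : ℕ) → DecidableEq (WildFly k n)
  | 0 => inferInstanceAs (DecidableEq (Fin k))
  | n + 1 =>
    have := WildFly.decEq k n
    inferInstanceAs (DecidableEq {ab : WildFly k n × WildFly k n // ab.1 ≠ ab.2})

instance WildFly.fintype (k : ℕ) : (n : ℕ) → Fintype (WildFly k n)
  | 0 => inferInstanceAs (Fintype (Fin k))
  | n + 1 =>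
    have := WildFly.fintype k n
    inferInstanceAs (Fintype {ab : WildFly k n × WildFly k n // ab.1 ≠ ab.2})

/-- The child `ab` of two distinct flies `a`, `b` of the same generation. -/
def WildFly.child {k n : ℕ} (a b : WildFly k n) (h : a ≠ b) : WildFly k (n + 1) := ⟨(a, b), h⟩

/-- The word over the alphabet `{1, ..., k}` that a wild fly stands for. -/
def WildFly.word {k : ℕ} : {n : ℕ} → WildFly k n → List (Fin k)
  | 0, a => [(show Fin k from a)]
  | _ + 1, a => WildFly.word a.1.1 ++ WildFly.word a.1.2

/-- The wild specie on `k` letters: the union of all generations. -/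
abbrev WildSpecie (k : ℕ) : Type := Σ n, WildFly k n

/-- The truncated polynomial ring `R` of the wild specie. -/
abbrev WildRing (p k : ℕ) (K : Type*) [Field K] : Type _ := TruncPoly p K (WildSpecie k)

/-- The variable `t_a` of a wild fly `a`. -/
def flyVar (p : ℕ) {k : ℕ} (K : Type*) [Field K] {n : ℕ} (a : WildFly k n) : WildRing p k K :=
  TruncPoly.t p K (⟨n, a⟩ : WildSpecie k)

/-- The partial derivation `∂_a` of a wild fly `a`. -/
def flyPd (p : ℕ) {k : ℕ} (K : Type*) [Field K] [CharP K p] {n : ℕ} (a : WildFly k n) :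
    Derivation K (WildRing p k K) (WildRing p k K) :=
  TruncPoly.pd p K (⟨n, a⟩ : WildSpecie k)

/-- The partial sums of the infinite sum defining the pivot element `v_a`: the recursion
`v_a = ∂_a + t_a^(p-1) ∑_{b ≠ a} t_b^(p-1) v_{ab}` is cut off after `j` generations. -/
def pivotTrunc (p : ℕ) {k : ℕ} (K : Type*) [Field K] [CharP K p] :
    ℕ → {n : ℕ} → WildFly k n → Derivation K (WildRing p k K) (WildRing p k K)
  | 0, _, _ => 0
  | j + 1, _, a => flyPd p K a + flyVar p K a ^ (p - 1) •
      ∑ b : {b // a ≠ b}, flyVar p K b.1 ^ (p - 1) • pivotTrunc p K j (a.child b.1 b.2)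

/-- The virtual pivot element `v_a`. Its value at the variable `t_d` of a fly `d` of generation
`m` only involves the terms of the infinite sum up to generation `m`. -/
def pivot (p : ℕ) {k : ℕ} (K : Type*) [Field K] [CharP K p] {n : ℕ} (a : WildFly k n) :
    Derivation K (WildRing p k K) (WildRing p k K) :=
  TruncPoly.mkDer p fun d => pivotTrunc p K (d.1 + 1) a (TruncPoly.t p K d)

theorem der_sum_apply {K A ι : Type*} [Field K] [CommRing A] [Algebra K A] (s : Finset ι)
    (D : ι → Derivation K A A) (x : A) : (∑ i ∈ s, D i) x = ∑ i ∈ s, D i x := by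
  classical
  induction s using Finset.induction_on with
  | empty => simp
  | insert i s hi ih => rw [Finset.sum_insert hi, Finset.sum_insert hi, Derivation.add_apply, ih]

theorem pivotTrunc_stable (p : ℕ) {k : ℕ} (K : Type*) [Field K] [CharP K p] (j : ℕ)
    (d : WildSpecie k) : ∀ {n : ℕ} (a : WildFly k n), d.1 < n + j →
      pivotTrunc p K (j + 1) a (TruncPoly.t p K d) = pivotTrunc p K j a (TruncPoly.t p K d) := by
  induction j with
  | zero =>
    intro n a h
    have hne : ¬ d = ⟨n, a⟩ := by rintro rfl; simp at h
    simp [pivotTrunc, flyPd, TruncPoly.pd, TruncPoly.mkDer_t, hne]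
  | succ j ih =>
    intro n a h
    conv_lhs => rw [pivotTrunc]
    conv_rhs => rw [pivotTrunc]
    simp only [Derivation.add_apply, Derivation.smul_apply, der_sum_apply]
    congr 2
    refine Finset.sum_congr rfl fun b _ => ?_
    rw [ih _ (by omega)]

/-- The defining recursion `v_a = ∂_a + t_a^(p-1) ∑_{b ≠ a} t_b^(p-1) v_{ab}`. -/
theorem pivot_eq (p : ℕ) {k : ℕ} (K : Type*) [Field K] [CharP K p] {n : ℕ} (a : WildFly k n) :
    pivot p K a = flyPd p K a + flyVar p K a ^ (p - 1) •
      ∑ b : {b // a ≠ b}, flyVar p K b.1 ^ (p - 1) • pivot p K (a.child b.1 b.2) := by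
  apply TruncPoly.der_ext
  intro d
  rw [pivot, TruncPoly.mkDer_t, pivotTrunc]
  simp only [Derivation.add_apply, Derivation.smul_apply, der_sum_apply]
  congr 2
  refine Finset.sum_congr rfl fun b _ => ?_
  rw [pivot, TruncPoly.mkDer_t, pivotTrunc_stable p K d.1 d _ (by omega)]

/-! ## The Lie algebra of the wild specie -/

/-- The pivot elements `v_1, ..., v_k` of generation zero. -/
def wildGens (p k : ℕ) (K : Type*) [Field K] [CharP K p] :
    Set (Derivation K (WildRing p k K) (WildRing p k K)) :=
  Set.range fun i : Fin k => pivot p K (n := 0) (show WildFly k 0 from i)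

/-- The drosophila algebra `Lie_p(v_1, ..., v_k)` of the wild specie on `k` letters. -/
abbrev wildLie (p k : ℕ) [Fact p.Prime] (K : Type*) [Field K] [CharP K p] :
    LieSubalgebra K (Derivation K (WildRing p k K) (WildRing p k K)) :=
  lieP p (wildGens p k K)

/-- The growth function of `Lie_p(v_1, ..., v_k)` with respect to `v_1, ..., v_k`. -/
def wildGrowth (p k : ℕ) [Fact p.Prime] (K : Type*) [Field K] [CharP K p] (n : ℕ) : ℕ :=
  growthFunction p K (L := wildLie p k K) (liePMap p (wildGens p k K))
    {x | (x : Derivation K (WildRing p k K) (WildRing p k K)) ∈ wildGens p k K} n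

end

/-! Let q_m be the number of flies of generation m, so 2^(2^m) < q_m ≤ k^(2^m), and put W =
(2p-1)^m. Give t_a the weight (2p-1)^n when a has generation n. Since 2p-1 = p + (p-1), all terms of
v_a have the same degree; thus L is graded by commutator length, and a pivot element of generation m
has degree W. In length N one expects roughly as many elements as there are words of length N/W in
q_m letters. If q_m is polynomially comparable to N, then 2^m is of order ln N, W is of order (ln
N)^(λ+1) because λ + 1 = log_2(2p-1), and q_m^(N/W) is the exponential of order N/(ln N)^λ.

Upper bound (`finite_derGrowth_and_wildGrowth_le`). Unfolding the recursion down to generation m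
expresses each v_i through the variables t and partials ∂ of generation below m and the pivots of
generation m, which kill these t and commute with these ∂. Every product then has a normal form in
the operators t^α ∂^β v_{w_1} ... v_{w_s} with exponents below p, and the weight bounds s by N/W
plus p times the number of low flies. It remains to count. If q_{m-1} ≤ √N < q_m, the low flies
contribute a negligible factor.

Lower bound (`choose_le_wildGrowth`). Three facts are combined. (1) `exists_mem_commSpan`: (ad
v_b)^(p-2) (ad v_a)^p v_b = t_b E - v_{ab}. Iterating this gives, for each fly a of generation m, a
combination of commutators of length exactly W that agrees with v_a modulo the variables of lower
generations. (2) `rightNormed_pivot_ne_zero`: a commutator of n different pivots of one generation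
is nonzero when 2n ≤ q_m. Give each a_i but the last two a partner d_i, all of these flies being
distinct. The part of the commutator of degree one in every a_i d_i and in the child bc of the last
two is a nonzero monomial times the commutator of the v_{a_i d_i} and v_{bc}. This commutator is one
letter shorter and lives one generation later, so induction applies. (3) Different n-element sets of
flies give different multidegrees, so these commutators are linearly independent, and passing to the
approximations of (1) preserves this. Hence the growth is at least C(q_m, n) with n = ⌊N/W⌋, and
this is at least N^n once q_m ≥ 2N^2. -/

noncomputable section

/-! ## Monomials and coefficients of truncated polynomials -/

namespace TruncPoly

variable {p : ℕ} {K σ : Type*} [Field K]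

/-- The image of the monomial with exponent `α`. -/
def mono (p : ℕ) (K : Type*) {σ : Type*} [Field K] (α : σ →₀ ℕ) : TruncPoly p K σ :=
  Ideal.Quotient.mk _ (MvPolynomial.monomial α 1)

theorem mono_add (α β : σ →₀ ℕ) : mono p K (α + β) = mono p K α * mono p K β := by
  rw [mono, mono, mono, ← map_mul, MvPolynomial.monomial_mul, one_mul]

theorem mono_zero : mono p K (0 : σ →₀ ℕ) = 1 := rfl

theorem mono_single (a : σ) (n : ℕ) : mono p K (Finsupp.single a n) = t p K a ^ n := by
  rw [mono, t, ← map_pow, MvPolynomial.X_pow_eq_monomial]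

theorem t_pow_p (a : σ) : t p K a ^ p = 0 := by
  rw [t, ← map_pow, Ideal.Quotient.eq_zero_iff_mem]
  exact Ideal.subset_span ⟨a, rfl⟩

theorem coeff_eq_zero_of_mem {q : MvPolynomial σ K}
    (hq : q ∈ Ideal.span (Set.range fun a : σ => (MvPolynomial.X a : MvPolynomial σ K) ^ p)) :
    ∀ α : σ →₀ ℕ, (∀ a, α a < p) → q.coeff α = 0 := by
  classical
  induction hq using Submodule.span_induction with
  | mem x hx =>
    obtain ⟨a, rfl⟩ := hx
    intro α hα
    beta_reduce
    rw [MvPolynomial.X_pow_eq_monomial, MvPolynomial.coeff_monomial, if_neg]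
    rintro rfl
    simpa using hα a
  | zero => simp
  | add x y _ _ hx hy => intro α hα; rw [MvPolynomial.coeff_add, hx α hα, hy α hα, add_zero]
  | smul r x _ hx =>
    intro α hα
    rw [smul_eq_mul, MvPolynomial.coeff_mul]
    refine Finset.sum_eq_zero fun ⟨β, γ⟩ h => ?_
    rw [Finset.HasAntidiagonal.mem_antidiagonal] at h
    rw [hx γ fun a => lt_of_le_of_lt ?_ (hα a), mul_zero]
    rw [← h, Finsupp.add_apply]
    exact Nat.le_add_left _ _

/-- The coefficient of a truncated polynomial at a monomial with exponents below `p`. -/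
def coeff (α : σ →₀ ℕ) (hα : ∀ a, α a < p) : TruncPoly p K σ →ₗ[K] K :=
  (Submodule.liftQ ((Ideal.span (Set.range fun a : σ =>
      (MvPolynomial.X a : MvPolynomial σ K) ^ p)).restrictScalars K)
    (MvPolynomial.lcoeff K α) (fun _ hq => coeff_eq_zero_of_mem hq α hα) :)

theorem coeff_mk (α : σ →₀ ℕ) (hα : ∀ a, α a < p) (q : MvPolynomial σ K) :
    coeff (K := K) α hα (Ideal.Quotient.mk _ q) = q.coeff α := rfl

theorem coeff_mono [DecidableEq σ] (α β : σ →₀ ℕ) (hα : ∀ a, α a < p) :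
    coeff (K := K) α hα (mono p K β) = if β = α then 1 else 0 := by
  rw [mono, coeff_mk, MvPolynomial.coeff_monomial]

theorem coeff_add_mono_mul (α β : σ →₀ ℕ) (hα : ∀ a, α a < p) (h : ∀ a, (β + α) a < p)
    (f : TruncPoly p K σ) : coeff (β + α) h (mono p K β * f) = coeff α hα f := by
  obtain ⟨q, rfl⟩ := Ideal.Quotient.mk_surjective f
  rw [mono, ← map_mul, coeff_mk, coeff_mk, MvPolynomial.coeff_monomial_mul, one_mul]

theorem coeff_mul_t (α : σ →₀ ℕ) (hα : ∀ a, α a < p) {b : σ} (hb : α b = 0)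
    (f : TruncPoly p K σ) : coeff α hα (f * t p K b) = 0 := by
  classical
  obtain ⟨q, rfl⟩ := Ideal.Quotient.mk_surjective f
  rw [t, ← map_mul, coeff_mk, MvPolynomial.coeff_mul_X', if_neg (by simpa using hb)]

theorem exists_coeff_ne_zero {f : TruncPoly p K σ} (hf : f ≠ 0) :
    ∃ (α : σ →₀ ℕ) (hα : ∀ a, α a < p), coeff α hα f ≠ 0 := by
  classical
  obtain ⟨q, rfl⟩ := Ideal.Quotient.mk_surjective f
  by_contra! h
  apply hf
  rw [Ideal.Quotient.eq_zero_iff_mem, MvPolynomial.as_sum q]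
  refine Ideal.sum_mem _ fun α hα => ?_
  have : ∃ a, p ≤ α a := by
    by_contra! hlt
    exact MvPolynomial.mem_support_iff.mp hα (h α hlt)
  obtain ⟨a, ha⟩ := this
  have he : α = (α - Finsupp.single a p) + Finsupp.single a p := by
    rw [tsub_add_cancel_of_le]
    exact Finsupp.single_le_iff.mpr ha
  rw [he, MvPolynomial.monomial_add_single]
  exact Ideal.mul_mem_left _ _ (Ideal.subset_span ⟨a, rfl⟩)

theorem one_ne_zero' (hp : 0 < p) : (1 : TruncPoly p K σ) ≠ 0 := by
  classical
  intro h
  have := coeff_mono (p := p) (K := K) (0 : σ →₀ ℕ) 0 (fun _ => hp)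
  rw [mono_zero, h, map_zero, if_pos rfl] at this
  exact zero_ne_one this

/-! ## Homogeneous elements and homogeneous derivations -/

variable {M : Type*} [AddCommGroup M]

/-- The span of the monomials of weight `e`, where the variable `t_a` has weight `wt a`. -/
def hom (p : ℕ) (K : Type*) {σ : Type*} [Field K] (wt : σ → M) (e : M) :
    Submodule K (TruncPoly p K σ) :=
  Submodule.span K {f | ∃ α, Finsupp.weight wt α = e ∧ f = mono p K α}

theorem mono_mem_hom (wt : σ → M) (α : σ →₀ ℕ) : mono p K α ∈ hom p K wt (Finsupp.weight wt α) :=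
  Submodule.subset_span ⟨α, rfl, rfl⟩

theorem t_pow_mem_hom (wt : σ → M) (a : σ) (n : ℕ) : t p K a ^ n ∈ hom p K wt (n • wt a) := by
  rw [← mono_single, ← Finsupp.weight_single]
  exact mono_mem_hom wt _

theorem one_mem_hom (wt : σ → M) : (1 : TruncPoly p K σ) ∈ hom p K wt 0 := by
  have := mono_mem_hom (p := p) (K := K) wt 0
  rwa [map_zero] at this

theorem mul_mem_hom {wt : σ → M} {e e' : M} {f g : TruncPoly p K σ} (hf : f ∈ hom p K wt e)
    (hg : g ∈ hom p K wt e') : f * g ∈ hom p K wt (e + e') := by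
  induction hf using Submodule.span_induction with
  | zero => rw [zero_mul]; exact zero_mem _
  | add x y _ _ hx hy => rw [add_mul]; exact add_mem hx hy
  | smul c x _ hx => rw [smul_mul_assoc]; exact Submodule.smul_mem _ _ hx
  | mem x hx =>
    obtain ⟨α, rfl, rfl⟩ := hx
    induction hg using Submodule.span_induction with
    | zero => rw [mul_zero]; exact zero_mem _
    | add x y _ _ hx hy => rw [mul_add]; exact add_mem hx hy
    | smul c x _ hx => rw [mul_smul_comm]; exact Submodule.smul_mem _ _ hx
    | mem x hx =>
      obtain ⟨β, rfl, rfl⟩ := hx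
      rw [← mono_add, ← map_add]
      exact mono_mem_hom wt _

/-- This is how gradings are exploited: a nonzero coefficient pins down the weight of its exponent,
so two elements of different weights cannot both have a nonzero coefficient at one monomial. -/
theorem weight_eq_of_coeff_ne_zero {wt : σ → M} {e : M} {f : TruncPoly p K σ}
    (hf : f ∈ hom p K wt e) {α : σ →₀ ℕ} {hα : ∀ a, α a < p} (h : coeff α hα f ≠ 0) :
    Finsupp.weight wt α = e := by
  classical
  by_contra hne
  apply h
  clear h
  induction hf using Submodule.span_induction with
  | zero => exact map_zero _
  | add x y _ _ hx hy => rw [map_add, hx, hy, add_zero]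
  | smul c x _ hx => rw [map_smul, hx, smul_zero]
  | mem x hx =>
    obtain ⟨β, rfl, rfl⟩ := hx
    rw [coeff_mono, if_neg]
    rintro rfl
    exact hne rfl

/-- A derivation that lowers the weight by `δ`. -/
def IsHom (wt : σ → M) (δ : M) (D : Derivation K (TruncPoly p K σ) (TruncPoly p K σ)) : Prop :=
  ∀ a, D (t p K a) ∈ hom p K wt (wt a - δ)

namespace IsHom

variable {wt : σ → M} {δ δ' : M} {D E : Derivation K (TruncPoly p K σ) (TruncPoly p K σ)}

theorem zero (wt : σ → M) (δ : M) : IsHom (p := p) (K := K) wt δ 0 := fun _ => zero_mem _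

theorem add (hD : IsHom wt δ D) (hE : IsHom wt δ E) : IsHom wt δ (D + E) :=
  fun a => add_mem (hD a) (hE a)

theorem smul (c : K) (hD : IsHom wt δ D) : IsHom wt δ (c • D) :=
  fun a => Submodule.smul_mem _ c (hD a)

theorem sum {ι : Type*} {s : Finset ι} {F : ι → Derivation K (TruncPoly p K σ) (TruncPoly p K σ)}
    (h : ∀ i ∈ s, IsHom wt δ (F i)) : IsHom wt δ (∑ i ∈ s, F i) := by
  intro a
  rw [der_sum_apply]
  exact Submodule.sum_mem _ fun i hi => h i hi a

theorem mul_smul {e : M} {f : TruncPoly p K σ} (hf : f ∈ hom p K wt e) (hD : IsHom wt δ D) :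
    IsHom wt (δ - e) (f • D) := by
  intro a
  have := mul_mem_hom hf (hD a)
  rwa [show e + (wt a - δ) = wt a - (δ - e) by abel] at this

/-- Being lowered by δ passes to products by the Leibniz rule, so it suffices to know it on the
variables. -/
theorem apply_mem (hD : IsHom wt δ D) {e : M} {f : TruncPoly p K σ} (hf : f ∈ hom p K wt e) :
    D f ∈ hom p K wt (e - δ) := by
  induction hf using Submodule.span_induction with
  | zero => rw [map_zero]; exact zero_mem _
  | add x y _ _ hx hy => rw [map_add]; exact add_mem hx hy
  | smul c x _ hx => rw [Derivation.map_smul]; exact Submodule.smul_mem _ _ hx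
  | mem x hx =>
    obtain ⟨α, rfl, rfl⟩ := hx
    have key : ∀ α β : σ →₀ ℕ,
        D (mono p K α) ∈ hom p K wt (Finsupp.weight wt α - δ) →
        D (mono p K β) ∈ hom p K wt (Finsupp.weight wt β - δ) →
        D (mono p K (α + β)) ∈ hom p K wt (Finsupp.weight wt (α + β) - δ) := by
      intro α β hα hβ
      rw [mono_add, Derivation.leibniz, map_add]
      refine add_mem ?_ ?_
      · rw [add_sub_assoc]; exact mul_mem_hom (mono_mem_hom wt α) hβ
      · rw [add_comm, add_sub_assoc]; exact mul_mem_hom (mono_mem_hom wt β) hα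
    have h0 : D (mono p K 0) ∈ hom p K wt (Finsupp.weight wt (0 : σ →₀ ℕ) - δ) := by
      rw [mono_zero, Derivation.map_one_eq_zero]; exact zero_mem _
    induction α using Finsupp.induction_linear with
    | zero => exact h0
    | add α β hα hβ => exact key α β hα hβ
    | single a n =>
      induction n with
      | zero => rw [Finsupp.single_zero]; exact h0
      | succ n ih =>
        rw [Finsupp.single_add]
        refine key _ _ ih ?_
        rw [mono_single, pow_one, Finsupp.weight_single, one_nsmul]
        exact hD a

theorem lie (hD : IsHom wt δ D) (hE : IsHom wt δ' E) : IsHom wt (δ + δ') ⁅D, E⁆ := by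
  intro a
  rw [Derivation.commutator_apply]
  refine sub_mem ?_ ?_
  · have := hD.apply_mem (hE a)
    rwa [show wt a - δ' - δ = wt a - (δ + δ') by abel] at this
  · have := hE.apply_mem (hD a)
    rwa [show wt a - δ - δ' = wt a - (δ + δ') by abel] at this

theorem pd [CharP K p] [DecidableEq σ] (wt : σ → M) (a : σ) :
    IsHom wt (wt a) (TruncPoly.pd p K a) := by
  intro b
  rw [TruncPoly.pd, mkDer_t]
  split_ifs with h
  · rw [h, sub_self]; exact one_mem_hom wt
  · exact zero_mem _

theorem weight_eq (hD : IsHom wt δ D) {α : σ →₀ ℕ} {hα : ∀ a, α a < p} {x : σ}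
    (h : coeff α hα (D (t p K x)) ≠ 0) : Finsupp.weight wt α = wt x - δ :=
  weight_eq_of_coeff_ne_zero (hD x) h

end IsHom

theorem exists_coeff_apply_ne_zero {D : Derivation K (TruncPoly p K σ) (TruncPoly p K σ)}
    (hD : D ≠ 0) : ∃ (x : σ) (α : σ →₀ ℕ) (hα : ∀ a, α a < p), coeff α hα (D (t p K x)) ≠ 0 := by
  by_contra! h
  refine hD (der_ext p fun a => ?_)
  by_contra hne
  obtain ⟨α, hα, h'⟩ := exists_coeff_ne_zero (f := D (t p K a)) hne
  exact h' (h a α hα)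

end TruncPoly

end

noncomputable section

/-! ## Gradings of the wild specie and homogeneity of the pivot elements -/

namespace WildFly

open TruncPoly

/-! ### Three weights: total degree, number of low variables, multiplicity of a given fly. -/

section Weights

variable {k : ℕ} {M : Type*} [AddCommGroup M]

/-- A weight function on flies for which the pivot elements of generation at least `g` are
homogeneous. -/
def Compatible (p g : ℕ) (wt : WildSpecie k → M) : Prop :=
  ∀ n, g ≤ n → ∀ (a b : WildFly k n) (h : a ≠ b),
    wt ⟨n + 1, a.child b h⟩ = p • wt ⟨n, a⟩ + (p - 1) • wt ⟨n, b⟩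

/-- The left side is the degree of t_a^(p-1) t_b^(p-1) v_{ab}, the right side that of ∂_a:
compatibility is precisely homogeneity of the recursion. -/
theorem Compatible.sub_sub {p g : ℕ} [hp : Fact p.Prime] {wt : WildSpecie k → M}
    (hwt : Compatible p g wt) {n : ℕ} (hn : g ≤ n) (a b : WildFly k n) (h : a ≠ b) :
    wt ⟨n + 1, a.child b h⟩ - (p - 1) • wt ⟨n, b⟩ - (p - 1) • wt ⟨n, a⟩ = wt ⟨n, a⟩ := by
  rw [hwt n hn a b h, add_sub_cancel_right, sub_eq_iff_eq_add, ← succ_nsmul',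
    Nat.sub_add_cancel hp.out.one_lt.le]

/-- The weight of a fly of generation `n` is `(2 p - 1) ^ n`. -/
def genWeight (p k : ℕ) (x : WildSpecie k) : ℤ := (2 * p - 1) ^ x.1

theorem compatible_genWeight (p k : ℕ) [hp : Fact p.Prime] : Compatible p 0 (genWeight p k) := by
  intro n _ a b h
  have h1 : ((p - 1 : ℕ) : ℤ) = p - 1 := by
    rw [Nat.cast_sub hp.out.one_lt.le, Nat.cast_one]
  simp only [genWeight, nsmul_eq_mul, h1]
  ring

/-- The weight that counts the variables of generation below `g`. -/
def lowWeight (k g : ℕ) (x : WildSpecie k) : ℤ := if x.1 < g then 1 else 0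

theorem lowWeight_of_le {k g : ℕ} {x : WildSpecie k} (h : g ≤ x.1) : lowWeight k g x = 0 :=
  if_neg (not_lt.mpr h)

/-- Since all flies from generation g on have weight zero, a pivot of such a generation has degree
zero, and its values on their variables contain no variable of generation below g. -/
theorem compatible_lowWeight (p k g : ℕ) : Compatible p g (lowWeight k g) := by
  intro n hn a b h
  rw [lowWeight_of_le (x := ⟨n, a⟩) hn, lowWeight_of_le (x := ⟨n, b⟩) hn,
    lowWeight_of_le (x := ⟨n + 1, _⟩) (hn.trans n.le_succ), smul_zero, smul_zero, add_zero]

/-- The multiplicity of the fly `y` in another fly, as dictated by the degree of pivot elements. -/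
def letterWeightAux (p : ℕ) {k : ℕ} (y : WildSpecie k) : (n : ℕ) → WildFly k n → ℤ
  | 0, a => if (⟨0, a⟩ : WildSpecie k) = y then 1 else 0
  | n + 1, a => p • letterWeightAux p y n a.1.1 + (p - 1) • letterWeightAux p y n a.1.2 +
      if (⟨n + 1, a⟩ : WildSpecie k) = y then 1 else 0

/-- The multiplicity of the fly `y` in another fly, as dictated by the degree of pivot elements. -/
def letterWeight (p : ℕ) {k : ℕ} (y x : WildSpecie k) : ℤ := letterWeightAux p y x.1 x.2

theorem letterWeight_of_lt (p : ℕ) {k : ℕ} (y : WildSpecie k) :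
    ∀ {n : ℕ} (a : WildFly k n), n < y.1 → letterWeight p y ⟨n, a⟩ = 0 := by
  intro n
  induction n with
  | zero =>
    intro a h
    exact if_neg (by rintro rfl; exact lt_irrefl _ h)
  | succ n ih =>
    intro a h
    change p • letterWeight p y ⟨n, a.1.1⟩ + (p - 1) • letterWeight p y ⟨n, a.1.2⟩ +
      (if (⟨n + 1, a⟩ : WildSpecie k) = y then 1 else 0) = 0
    rw [ih _ (by omega), ih _ (by omega), if_neg (by rintro rfl; exact lt_irrefl _ h)]
    simp

theorem letterWeight_of_le (p : ℕ) {k : ℕ} (y x : WildSpecie k) (h : x.1 ≤ y.1) :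
    letterWeight p y x = if x = y then 1 else 0 := by
  obtain ⟨n, a⟩ := x
  cases n with
  | zero => rfl
  | succ n =>
    change p • letterWeight p y ⟨n, a.1.1⟩ + (p - 1) • letterWeight p y ⟨n, a.1.2⟩ +
      (if (⟨n + 1, a⟩ : WildSpecie k) = y then 1 else 0) = _
    rw [letterWeight_of_lt p y _ (by simp only at h; omega),
      letterWeight_of_lt p y _ (by simp only at h; omega)]
    simp

/-- The correction term equal to 1 at `y` never occurs at a child of flies of generation at least
`y.1`, because the child is younger than `y`. -/
theorem compatible_letterWeight (p : ℕ) {k : ℕ} (y : WildSpecie k) :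
    Compatible p y.1 (letterWeight p y) := by
  intro n hn a b h
  change p • letterWeight p y ⟨n, a⟩ + (p - 1) • letterWeight p y ⟨n, b⟩ +
    (if (⟨n + 1, a.child b h⟩ : WildSpecie k) = y then 1 else 0) = _
  rw [if_neg (by rintro rfl; simp at hn), add_zero]

end Weights

/-! ### Values and commutators of pivot elements and partial derivations. -/

section Pivot

variable {p k : ℕ} {K : Type*} [Field K] [CharP K p] {M : Type*} [AddCommGroup M]

theorem isHom_pivotTrunc [Fact p.Prime] {g : ℕ} {wt : WildSpecie k → M}
    (hwt : Compatible p g wt) (j : ℕ) : ∀ {n : ℕ} (a : WildFly k n), g ≤ n →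
      IsHom wt (wt ⟨n, a⟩) (pivotTrunc p K j a) := by
  induction j with
  | zero => intro n a _; exact IsHom.zero wt _
  | succ j ih =>
    intro n a hn
    rw [pivotTrunc]
    refine (IsHom.pd wt _).add ?_
    rw [Finset.smul_sum]
    refine IsHom.sum fun b _ => ?_
    have := IsHom.mul_smul (t_pow_mem_hom wt (⟨n, a⟩ : WildSpecie k) (p - 1))
      (IsHom.mul_smul (t_pow_mem_hom wt (⟨n, b.1⟩ : WildSpecie k) (p - 1))
        (ih (a.child b.1 b.2) (by omega)))
    rwa [hwt.sub_sub hn] at this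

theorem isHom_pivot [Fact p.Prime] {g : ℕ} {wt : WildSpecie k → M}
    (hwt : Compatible p g wt) {n : ℕ} (a : WildFly k n) (hn : g ≤ n) :
    IsHom wt (wt ⟨n, a⟩) (pivot p K a) := by
  intro d
  rw [pivot, mkDer_t]
  exact isHom_pivotTrunc hwt _ a hn d

theorem flyPd_t {n : ℕ} (a : WildFly k n) (d : WildSpecie k) :
    flyPd p K a (t p K d) = if d = ⟨n, a⟩ then 1 else 0 := by
  rw [flyPd, pd, mkDer_t]

theorem pivotTrunc_t_of_lt (j : ℕ) (d : WildSpecie k) : ∀ {n : ℕ} (a : WildFly k n), d.1 < n →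
    pivotTrunc p K j a (t p K d) = 0 := by
  induction j with
  | zero => intro n a _; rfl
  | succ j ih =>
    intro n a h
    rw [pivotTrunc, Derivation.add_apply, flyPd_t, if_neg (by rintro rfl; exact lt_irrefl _ h),
      zero_add, Derivation.smul_apply, der_sum_apply, Finset.sum_eq_zero, smul_zero]
    intro b _
    rw [Derivation.smul_apply, ih _ (by omega), smul_zero]

theorem pivot_t_of_le {n : ℕ} (a : WildFly k n) (d : WildSpecie k) (h : d.1 ≤ n) :
    pivot p K a (t p K d) = if d = ⟨n, a⟩ then 1 else 0 := by
  rw [pivot, mkDer_t, pivotTrunc, Derivation.add_apply, flyPd_t, Derivation.smul_apply,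
    der_sum_apply, Finset.sum_eq_zero, smul_zero, add_zero]
  intro b _
  rw [Derivation.smul_apply, pivotTrunc_t_of_lt _ _ _ (by omega), smul_zero]

theorem pivot_flyVar_of_lt {n m : ℕ} (a : WildFly k n) (d : WildFly k m) (h : m < n) :
    pivot p K a (flyVar p K d) = 0 := by
  rw [flyVar, pivot_t_of_le a _ h.le, if_neg]
  intro h'
  exact h.ne (congrArg Sigma.fst h')

theorem flyVar_ne {n : ℕ} {a d : WildFly k n} (h : d ≠ a) :
    (⟨n, d⟩ : WildSpecie k) ≠ ⟨n, a⟩ := by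
  intro h'
  exact h (eq_of_heq (Sigma.mk.inj h').2)

theorem pivot_flyVar_ne {n : ℕ} (a d : WildFly k n) (h : d ≠ a) :
    pivot p K a (flyVar p K d) = 0 := by
  rw [flyVar, pivot_t_of_le a _ le_rfl, if_neg (flyVar_ne h)]

theorem pivot_flyVar_self {n : ℕ} (a : WildFly k n) : pivot p K a (flyVar p K a) = 1 := by
  rw [flyVar, pivot_t_of_le a _ le_rfl, if_pos rfl]

theorem flyPd_flyVar_ne {n m : ℕ} (a : WildFly k n) (d : WildFly k m)
    (h : (⟨m, d⟩ : WildSpecie k) ≠ ⟨n, a⟩) : flyPd p K a (flyVar p K d) = 0 := by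
  rw [flyVar, flyPd_t, if_neg h]

theorem flyPd_flyVar_self {n : ℕ} (a : WildFly k n) : flyPd p K a (flyVar p K a) = 1 := by
  rw [flyVar, flyPd_t, if_pos rfl]

theorem pow_apply_eq_zero {A : Type*} [CommRing A] [Algebra K A] (D : Derivation K A A) {x : A}
    (h : D x = 0) (n : ℕ) : D (x ^ n) = 0 := by
  rw [Derivation.leibniz_pow, h, smul_zero, smul_zero]

theorem flyPd_pivotTrunc_t {m : ℕ} (c : WildFly k m) (j : ℕ) (d : WildSpecie k) :
    ∀ {n : ℕ} (a : WildFly k n), m < n → flyPd p K c (pivotTrunc p K j a (t p K d)) = 0 := by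
  induction j with
  | zero => intro n a _; exact map_zero _
  | succ j ih =>
    intro n a h
    have hv : ∀ b : WildFly k n, flyPd p K c (flyVar p K b ^ (p - 1)) = 0 := fun b =>
      pow_apply_eq_zero _ (flyPd_flyVar_ne c b fun h' => h.ne' (congrArg Sigma.fst h')) _
    rw [pivotTrunc, Derivation.add_apply, flyPd_t, map_add, Derivation.smul_apply, der_sum_apply,
      smul_eq_mul, Derivation.leibniz, hv, smul_zero, add_zero, map_sum, Finset.sum_eq_zero,
      smul_zero, add_zero]
    · split_ifs
      · exact Derivation.map_one_eq_zero _
      · exact map_zero _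
    · intro b _
      rw [Derivation.smul_apply, smul_eq_mul, Derivation.leibniz, hv, smul_zero, add_zero,
        ih _ (by omega), smul_zero]

theorem lie_flyPd_flyPd {m n : ℕ} (c : WildFly k m) (d : WildFly k n) :
    ⁅flyPd p K c, flyPd p K d⁆ = 0 := by
  apply der_ext
  intro x
  rw [Derivation.commutator_apply, flyPd_t, flyPd_t, Derivation.zero_apply]
  split_ifs <;> simp

/-- Only variables of generation at least that of `a` occur in the coefficients of v_a, so an older
∂_c sees constants. -/
theorem lie_flyPd_pivot {m n : ℕ} (c : WildFly k m) (a : WildFly k n) (h : m < n) :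
    ⁅flyPd p K c, pivot p K a⁆ = 0 := by
  apply der_ext
  intro x
  rw [Derivation.commutator_apply, flyPd_t, pivot, mkDer_t, flyPd_pivotTrunc_t c _ _ a h,
    Derivation.zero_apply]
  split_ifs <;> simp

end Pivot

end WildFly

end

noncomputable section

/-! ## Multilinear commutators of pivot elements do not vanish -/

/-! ### Bracket identities for derivations with coefficients in the ring. -/

section Derivations

variable {K A : Type*} [Field K] [CommRing A] [Algebra K A]

theorem der_lie_smul (D E : Derivation K A A) (f : A) :
    ⁅D, f • E⁆ = f • ⁅D, E⁆ + D f • E := by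
  ext x
  simp only [Derivation.commutator_apply, Derivation.smul_apply, Derivation.add_apply, smul_eq_mul,
    Derivation.leibniz]
  ring

theorem der_smul_lie (D E : Derivation K A A) (f : A) :
    ⁅f • D, E⁆ = f • ⁅D, E⁆ - E f • D := by
  ext x
  simp only [Derivation.commutator_apply, Derivation.smul_apply, Derivation.sub_apply, smul_eq_mul,
    Derivation.leibniz]
  ring

theorem der_lie_apply_eq_zero {D E : Derivation K A A} {x : A} (hD : D x = 0) (hE : E x = 0) :
    ⁅D, E⁆ x = 0 := by
  rw [Derivation.commutator_apply, hD, hE, map_zero, map_zero, sub_zero]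

theorem der_lie_add (D E F : Derivation K A A) : ⁅D, E + F⁆ = ⁅D, E⁆ + ⁅D, F⁆ := lie_add _ _ _

theorem der_lie_zero (D : Derivation K A A) : ⁅D, (0 : Derivation K A A)⁆ = 0 := lie_zero _

theorem der_lie_scalar_smul (c : K) (D E : Derivation K A A) : ⁅D, c • E⁆ = c • ⁅D, E⁆ := by
  ext x
  simp only [Derivation.commutator_apply, Derivation.smul_apply, Derivation.map_smul, smul_sub]

theorem der_lie_eq_zero_symm {D E : Derivation K A A} (h : ⁅D, E⁆ = 0) : ⁅E, D⁆ = 0 := by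
  rw [← lie_skew, h, neg_zero]

theorem der_smul_smul (f g : A) (D : Derivation K A A) : f • g • D = (f * g) • D := smul_smul _ _ _

theorem der_lie_smul_of_eq_zero {D : Derivation K A A} {f : A} (h : D f = 0)
    (E : Derivation K A A) : ⁅D, f • E⁆ = f • ⁅D, E⁆ := by
  rw [der_lie_smul, h, zero_smul, add_zero]

theorem der_lie_smul_add {a Z H Y B : Derivation K A A} {w m : A} (ha : a = w • Z + H)
    (hm : a m = 0) (hY : Y w = 0) :
    ⁅a, m • Y + B⁆ = (w * m) • ⁅Z, Y⁆ + (⁅a, B⁆ + m • ⁅H, Y⁆) := by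
  have h : ⁅a, Y⁆ = w • ⁅Z, Y⁆ + ⁅H, Y⁆ := by
    rw [ha, add_lie, der_smul_lie, hY, zero_smul, sub_zero]
  rw [lie_add, der_lie_smul_of_eq_zero hm, h, smul_add, smul_smul, mul_comm m w]
  abel

theorem natCast_self_eq_zero (K A : Type*) [Field K] [CommRing A] [Algebra K A] (p : ℕ)
    [CharP K p] : (p : A) = 0 := by
  have h := map_natCast (algebraMap K A) p
  rw [CharP.cast_eq_zero, map_zero] at h
  exact h.symm

/-- With s = t_a and r = t_b this extracts t_a^(p-1) t_b^(p-2) v_{ab} from [v_a, v_b]. The second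
factor differentiates r^(p-1), and p - 1 = -1 in characteristic p cancels the sign. The remaining
bracket with Y is a multiple of r^(2p-2) = 0. -/
theorem der_lie_leading {p : ℕ} [CharP K p] (hp : 2 ≤ p) {b c d Y U H : Derivation K A A}
    {s r : A} (hb : b = (s ^ (p - 1) * r ^ (p - 1)) • Y + H) (hc : c = d + r ^ (p - 1) • U)
    (hs : c s = 0) (hr : c r = 1) (hY : ⁅Y, d⁆ = 0) (hYr : Y r = 0) (hrp : r ^ p = 0) :
    ⁅b, c⁆ = (s ^ (p - 1) * r ^ (p - 2)) • Y + ⁅H, c⁆ := by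
  have hpr : (p - 1 : ℕ) • r ^ (p - 1 - 1) = -r ^ (p - 2) := by
    rw [nsmul_eq_mul, Nat.cast_sub (by omega), natCast_self_eq_zero K A p, Nat.cast_one,
      show p - 1 - 1 = p - 2 by omega]
    ring
  have hder : c (s ^ (p - 1) * r ^ (p - 1)) = -(s ^ (p - 1) * r ^ (p - 2)) := by
    have hs' : c (s ^ (p - 1)) = 0 := by rw [Derivation.leibniz_pow, hs, smul_zero, smul_zero]
    rw [Derivation.leibniz, hs', smul_zero, add_zero, Derivation.leibniz_pow, hr,
      smul_eq_mul (r ^ (p - 1 - 1)), mul_one, hpr, smul_eq_mul]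
    ring
  have hzero : (s ^ (p - 1) * r ^ (p - 1)) • ⁅Y, c⁆ = 0 := by
    have h2 : r ^ (p - 1) * r ^ (p - 1) = 0 := by
      rw [← pow_add]; exact pow_eq_zero_of_le (by omega) hrp
    have h3 : Y (r ^ (p - 1)) = 0 := by rw [Derivation.leibniz_pow, hYr, smul_zero, smul_zero]
    rw [hc, lie_add, hY, zero_add, der_lie_smul_of_eq_zero h3, smul_smul, mul_assoc, h2, mul_zero,
      zero_smul]
  conv_lhs => rw [hb, add_lie, der_smul_lie, hzero, hder, zero_sub, neg_smul, neg_neg]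

end Derivations

theorem rightNormed_cons {L : Type*} [LieRing L] (x : L) {l : List L} (h : l ≠ []) :
    rightNormed (x :: l) = ⁅x, rightNormed l⁆ := by
  cases l with
  | nil => exact absurd rfl h
  | cons y l => rfl

theorem rightNormed_concat {L : Type*} [LieRing L] (l : List L) (z : L) :
    rightNormed (l ++ [z]) = l.foldr (fun x y => ⁅x, y⁆) z := by
  induction l with
  | nil => rfl
  | cons x l ih => rw [List.cons_append, rightNormed_cons _ (by simp), ih, List.foldr_cons]

namespace WildFly

open TruncPoly

/-- The first half of a fly. -/
def fst {k n : ℕ} (y : WildFly k (n + 1)) : WildFly k n := y.1.1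

/-- The second half of a fly. -/
def snd {k n : ℕ} (y : WildFly k (n + 1)) : WildFly k n := y.1.2

theorem fst_ne_snd {k n : ℕ} (y : WildFly k (n + 1)) : y.fst ≠ y.snd := y.2

/-- The commutator `[v_{a_1}, [..., [v_{a_s}, Z]]]`. -/
def chain (p : ℕ) {k : ℕ} (K : Type*) [Field K] [CharP K p] {n : ℕ} (l : List (WildFly k n))
    (Z : Derivation K (WildRing p k K) (WildRing p k K)) :
    Derivation K (WildRing p k K) (WildRing p k K) :=
  l.foldr (fun a Z => ⁅pivot p K a, Z⁆) Z

theorem letterWeight_same (p : ℕ) {k n : ℕ} (z a : WildFly k n) :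
    letterWeight p (⟨n, z⟩ : WildSpecie k) ⟨n, a⟩ = if a = z then 1 else 0 := by
  rw [letterWeight_of_le p (⟨n, z⟩ : WildSpecie k) (⟨n, a⟩ : WildSpecie k) le_rfl]
  by_cases h : a = z
  · subst h; rw [if_pos rfl, if_pos rfl]
  · rw [if_neg h, if_neg (flyVar_ne h)]

variable {p k : ℕ} {K : Type*} [Field K] [CharP K p]

theorem rightNormed_pivot_concat {n : ℕ} (l : List (WildFly k n)) (z : WildFly k n) :
    rightNormed ((l ++ [z]).map (pivot p K)) = chain p K l (pivot p K z) := by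
  rw [List.map_append, List.map_singleton, rightNormed_concat, List.foldr_map, chain]

theorem chain_apply_eq_zero {n : ℕ} (l : List (WildFly k n)) {x : WildRing p k K}
    {Z : Derivation K (WildRing p k K) (WildRing p k K)} (h : ∀ a : WildFly k n, pivot p K a x = 0)
    (hZ : Z x = 0) : chain p K l Z x = 0 := by
  induction l with
  | nil => exact hZ
  | cons a l ih => exact der_lie_apply_eq_zero (h a) ih

variable [Fact p.Prime]

theorem isHom_chain {M : Type*} [AddCommGroup M] {g : ℕ} {wt : WildSpecie k → M}
    (hwt : Compatible p g wt) {n : ℕ} (hn : g ≤ n) (l : List (WildFly k n)) {δ : M}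
    {Z : Derivation K (WildRing p k K) (WildRing p k K)} (hZ : IsHom wt δ Z) :
    IsHom wt ((l.map fun a => wt ⟨n, a⟩).sum + δ) (chain p K l Z) := by
  induction l with
  | nil => rw [List.map_nil, List.sum_nil, zero_add]; exact hZ
  | cons a l ih =>
    rw [List.map_cons, List.sum_cons, add_assoc]
    exact (isHom_pivot hwt a hn).lie ih

theorem isHom_pivot_low {g n : ℕ} (a : WildFly k n) (hn : g ≤ n) :
    IsHom (lowWeight k g) 0 (pivot p K a) := by
  have := isHom_pivot (K := K) (compatible_lowWeight p k g) a hn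
  rwa [lowWeight_of_le (x := ⟨n, a⟩) hn] at this

theorem isHom_chain_low {g n : ℕ} (hn : g ≤ n) (l : List (WildFly k n))
    {Z : Derivation K (WildRing p k K) (WildRing p k K)} (hZ : IsHom (lowWeight k g) 0 Z) :
    IsHom (lowWeight k g) 0 (chain p K l Z) := by
  induction l with
  | nil => exact hZ
  | cons a l ih =>
    have := (isHom_pivot_low (p := p) (K := K) a hn).lie ih
    rwa [add_zero] at this

omit [CharP K p] [Fact p.Prime] in
-- The low weight counts low variables with multiplicity, and it must vanish here.
theorem coeff_support_of_isHom {g : ℕ} {D : Derivation K (WildRing p k K) (WildRing p k K)}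
    (hD : IsHom (lowWeight k g) 0 D) {x : WildSpecie k} {α : WildSpecie k →₀ ℕ}
    {hα : ∀ a, α a < p} (h : coeff α hα (D (t p K x)) ≠ 0) (hx : g ≤ x.1) (y : WildSpecie k)
    (hy : y.1 < g) : α y = 0 := by
  have h1 := hD.weight_eq h
  rw [lowWeight_of_le hx, sub_zero, Finsupp.weight_apply, Finsupp.sum] at h1
  by_contra hne
  have h2 := (Finset.sum_eq_zero_iff_of_nonneg (fun i _ => by
    rw [lowWeight]; split_ifs <;> simp)).mp h1 y (Finsupp.mem_support_iff.mpr hne)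
  rw [lowWeight, if_pos hy] at h2
  simp at h2
  exact hne h2

/-- Thus the multidegree of a commutator in flies of one generation recovers the multiset of its
letters. -/
theorem isHom_chain_letter {n : ℕ} (z : WildFly k n) (l : List (WildFly k n)) (y : WildFly k n) :
    IsHom (letterWeight p (⟨n, z⟩ : WildSpecie k)) (((l ++ [y]).count z : ℕ) : ℤ)
      (chain p K l (pivot p K y)) := by
  have h := isHom_chain (K := K) (compatible_letterWeight p (⟨n, z⟩ : WildSpecie k)) le_rfl l
    (isHom_pivot (compatible_letterWeight p (⟨n, z⟩ : WildSpecie k)) y le_rfl)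
  convert h using 1
  have hl : ∀ l : List (WildFly k n), ((l.count z : ℕ) : ℤ) =
      (l.map fun a => letterWeight p (⟨n, z⟩ : WildSpecie k) ⟨n, a⟩).sum := by
    intro l
    induction l with
    | nil => rfl
    | cons a l ih =>
      rw [List.count_cons, List.map_cons, List.sum_cons, ← ih, letterWeight_same]
      by_cases ha : a = z
      · simp [ha, add_comm]
      · simp [ha]
  rw [hl, List.map_append, List.sum_append]
  simp

theorem isHom_term {g : ℕ} (z : WildFly k (g + 1)) (a b : WildFly k g) (h : a ≠ b) :
    IsHom (letterWeight p (⟨g + 1, z⟩ : WildSpecie k)) (if a.child b h = z then 1 else 0)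
      (flyVar p K a ^ (p - 1) • flyVar p K b ^ (p - 1) • pivot p K (a.child b h)) := by
  have h0 : ∀ c : WildFly k g, letterWeight p (⟨g + 1, z⟩ : WildSpecie k) ⟨g, c⟩ = 0 :=
    fun c => letterWeight_of_lt p _ c (Nat.lt_succ_self g)
  have := IsHom.mul_smul (t_pow_mem_hom (letterWeight p (⟨g + 1, z⟩ : WildSpecie k))
    (⟨g, a⟩ : WildSpecie k) (p - 1)) (IsHom.mul_smul (t_pow_mem_hom _ (⟨g, b⟩ : WildSpecie k) (p - 1))
    (isHom_pivot (K := K) (compatible_letterWeight p (⟨g + 1, z⟩ : WildSpecie k))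
      (a.child b h) le_rfl))
  rwa [h0, h0, smul_zero, sub_zero, sub_zero, letterWeight_same] at this

omit [Fact p.Prime] in
theorem isHom_flyPd_letter {g : ℕ} (z : WildFly k (g + 1)) (a : WildFly k g) :
    IsHom (letterWeight p (⟨g + 1, z⟩ : WildSpecie k)) 0 (flyPd p K a) := by
  have := IsHom.pd (p := p) (K := K) (letterWeight p (⟨g + 1, z⟩ : WildSpecie k))
    (⟨g, a⟩ : WildSpecie k)
  rwa [letterWeight_of_lt p _ a (Nat.lt_succ_self g)] at this

/-- A pivot element is homogeneous of degree zero with respect to a fly of the next generation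
whose first half is different. -/
theorem isHom_pivot_letter {g : ℕ} (z : WildFly k (g + 1)) (a : WildFly k g) (h : a ≠ z.fst) :
    IsHom (letterWeight p (⟨g + 1, z⟩ : WildSpecie k)) 0 (pivot p K a) := by
  rw [pivot_eq, Finset.smul_sum]
  refine (isHom_flyPd_letter z a).add (IsHom.sum fun b _ => ?_)
  have := isHom_term (p := p) (K := K) z a b.1 b.2
  rwa [if_neg] at this
  rintro rfl
  exact h rfl

/-- Exactly one summand in the recursion for the pivot of `z.fst` has degree one in `z`; all others
have degree zero. -/
theorem exists_pivot_eq {g : ℕ} (z : WildFly k (g + 1)) :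
    ∃ H, IsHom (letterWeight p (⟨g + 1, z⟩ : WildSpecie k)) 0 H ∧ pivot p K z.fst =
      (flyVar p K z.fst ^ (p - 1) * flyVar p K z.snd ^ (p - 1)) • pivot p K z + H := by
  classical
  refine ⟨flyPd p K z.fst + ∑ b ∈ Finset.univ.erase (⟨z.snd, z.fst_ne_snd⟩ : {b // z.fst ≠ b}),
    flyVar p K z.fst ^ (p - 1) • flyVar p K b.1 ^ (p - 1) • pivot p K (z.fst.child b.1 b.2),
    ?_, ?_⟩
  · refine (isHom_flyPd_letter z _).add (IsHom.sum fun b hb => ?_)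
    have := isHom_term (p := p) (K := K) z z.fst b.1 b.2
    rwa [if_neg] at this
    intro h
    refine Finset.ne_of_mem_erase hb (Subtype.ext ?_)
    exact congrArg (fun w : WildFly k (g + 1) => w.snd) h
  · conv_lhs => rw [pivot_eq, Finset.smul_sum]
    rw [← Finset.add_sum_erase _ _ (Finset.mem_univ (⟨z.snd, z.fst_ne_snd⟩ : {b // z.fst ≠ b})),
      add_left_comm, der_smul_smul]
    rfl

/-- The span of the derivations that are homogeneous of degree other than one with respect to
some fly in `T`. -/
def offDegree (p : ℕ) {k : ℕ} (K : Type*) [Field K] (T : Set (WildSpecie k)) :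
    Submodule K (Derivation K (WildRing p k K) (WildRing p k K)) :=
  Submodule.span K {D | ∃ y ∈ T, ∃ e : ℤ, e ≠ 1 ∧ IsHom (letterWeight p y) e D}

omit [CharP K p] [Fact p.Prime] in
theorem mem_offDegree {T : Set (WildSpecie k)} {y : WildSpecie k} (hy : y ∈ T)
    {D : Derivation K (WildRing p k K) (WildRing p k K)} (hD : IsHom (letterWeight p y) 0 D) :
    D ∈ offDegree p K T :=
  Submodule.subset_span ⟨y, hy, 0, zero_ne_one, hD⟩

omit [CharP K p] [Fact p.Prime] in
theorem offDegree_mono {T T' : Set (WildSpecie k)} (h : T ⊆ T') :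
    offDegree p K T ≤ offDegree p K T' :=
  Submodule.span_mono fun _ ⟨y, hy, he⟩ => ⟨y, h hy, he⟩

omit [CharP K p] [Fact p.Prime] in
theorem lie_mem_offDegree {T : Set (WildSpecie k)}
    {D B : Derivation K (WildRing p k K) (WildRing p k K)}
    (hD : ∀ y ∈ T, IsHom (letterWeight p y) 0 D) (hB : B ∈ offDegree p K T) :
    ⁅D, B⁆ ∈ offDegree p K T := by
  induction hB using Submodule.span_induction with
  | zero => rw [der_lie_zero]; exact zero_mem _
  | add x y _ _ hx hy => rw [der_lie_add]; exact add_mem hx hy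
  | smul c x _ hx => rw [der_lie_scalar_smul]; exact Submodule.smul_mem _ _ hx
  | mem x hx =>
    obtain ⟨y, hy, e, he, hx⟩ := hx
    refine Submodule.subset_span ⟨y, hy, e, he, ?_⟩
    have := (hD y hy).lie hx
    rwa [zero_add] at this

omit [CharP K p] [Fact p.Prime] in
-- A monomial of degree one in every fly of `T` receives nothing from a term whose degree in some
-- fly of `T` is not one. This discards the error terms without computing them.
theorem coeff_offDegree {T : Set (WildSpecie k)}
    {B : Derivation K (WildRing p k K) (WildRing p k K)} (hB : B ∈ offDegree p K T)
    {x : WildSpecie k} {α : WildSpecie k →₀ ℕ} (hα : ∀ a, α a < p)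
    (h : ∀ y ∈ T, letterWeight p y x - Finsupp.weight (letterWeight p y) α = 1) :
    coeff α hα (B (t p K x)) = 0 := by
  induction hB using Submodule.span_induction with
  | zero => rw [Derivation.zero_apply, map_zero]
  | add D E _ _ hx hy => rw [Derivation.add_apply, map_add, hx, hy, add_zero]
  | smul c D _ hx => rw [Derivation.smul_apply, map_smul, hx, smul_zero]
  | mem D hD =>
    obtain ⟨y, hy, e, he, hD⟩ := hD
    by_contra hne
    have := hD.weight_eq hne
    have := h y hy
    omega

/-- The first and second halves of the flies in a list, followed by the two halves of `y₀`. -/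
def halves {k g : ℕ} (y₀ : WildFly k (g + 1)) : List (WildFly k (g + 1)) → List (WildFly k g)
  | [] => [y₀.fst, y₀.snd]
  | y :: L => y.fst :: y.snd :: halves y₀ L

/-- The exponent of the monomial at the leading term of a commutator. -/
def leadExp (p : ℕ) {k g : ℕ} (y₀ : WildFly k (g + 1)) :
    List (WildFly k (g + 1)) → (WildSpecie k →₀ ℕ)
  | [] => Finsupp.single ⟨g, y₀.fst⟩ (p - 1) + Finsupp.single ⟨g, y₀.snd⟩ (p - 2)
  | y :: L => (Finsupp.single ⟨g, y.fst⟩ (p - 1) + Finsupp.single ⟨g, y.snd⟩ (p - 1)) +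
      leadExp p y₀ L

theorem leadExp_of_ne (p : ℕ) {k g : ℕ} (y₀ : WildFly k (g + 1)) (L : List (WildFly k (g + 1)))
    (x : WildSpecie k) (hx : x.1 ≠ g) : leadExp p y₀ L x = 0 := by
  have h : ∀ (c : WildFly k g) (n : ℕ), Finsupp.single (⟨g, c⟩ : WildSpecie k) n x = 0 := by
    intro c n
    rw [Finsupp.single_apply, if_neg]
    rintro rfl
    exact hx rfl
  induction L with
  | nil => rw [leadExp, Finsupp.add_apply, h, h]
  | cons y L ih => rw [leadExp, Finsupp.add_apply, Finsupp.add_apply, h, h, ih]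

/-- When the halves are distinct, all exponents are at most p - 1, so the leading monomial survives
truncation. -/
theorem leadExp_le (p : ℕ) {k g : ℕ} (y₀ : WildFly k (g + 1)) (L : List (WildFly k (g + 1)))
    (c : WildFly k g) : leadExp p y₀ L ⟨g, c⟩ ≤ (p - 1) * (halves y₀ L).count c := by
  have h : ∀ (a : WildFly k g) (n : ℕ), Finsupp.single (⟨g, a⟩ : WildSpecie k) n ⟨g, c⟩ =
      if a = c then n else 0 := by
    intro a n
    rw [Finsupp.single_apply]
    by_cases hac : a = c
    · subst hac; rw [if_pos rfl, if_pos rfl]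
    · rw [if_neg hac, if_neg (flyVar_ne hac)]
  induction L with
  | nil =>
    rw [leadExp, halves, Finsupp.add_apply, h, h]
    simp only [List.count_cons, List.count_nil, beq_iff_eq, zero_add]
    split_ifs <;> omega
  | cons y L ih =>
    rw [leadExp, halves, Finsupp.add_apply, Finsupp.add_apply, h, h]
    simp only [List.count_cons, beq_iff_eq, mul_add]
    split_ifs <;> omega

omit [CharP K p] [Fact p.Prime] in
theorem mono_leadExp_cons {g : ℕ} (y₀ y : WildFly k (g + 1)) (L : List (WildFly k (g + 1))) :
    mono p K (leadExp p y₀ (y :: L)) = (flyVar p K y.fst ^ (p - 1) * flyVar p K y.snd ^ (p - 1)) *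
      mono p K (leadExp p y₀ L) := by
  rw [leadExp, mono_add, mono_add, mono_single, mono_single]
  rfl

omit [CharP K p] [Fact p.Prime] in
theorem mono_leadExp_nil {g : ℕ} (y₀ : WildFly k (g + 1)) :
    mono p K (leadExp p y₀ []) = flyVar p K y₀.fst ^ (p - 1) * flyVar p K y₀.snd ^ (p - 2) := by
  rw [leadExp, mono_add, mono_single, mono_single]
  rfl

omit [CharP K p] [Fact p.Prime] in
theorem apply_mul_eq_zero {D : Derivation K (WildRing p k K) (WildRing p k K)}
    {x y : WildRing p k K} (hx : D x = 0) (hy : D y = 0) : D (x * y) = 0 := by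
  rw [Derivation.leibniz, hx, hy, smul_zero, smul_zero, add_zero]

omit [CharP K p] [Fact p.Prime] in
theorem apply_mono_leadExp {g : ℕ} (y₀ : WildFly k (g + 1)) (L : List (WildFly k (g + 1)))
    {D : Derivation K (WildRing p k K) (WildRing p k K)}
    (hD : ∀ c ∈ halves y₀ L, D (flyVar p K c) = 0) : D (mono p K (leadExp p y₀ L)) = 0 := by
  induction L with
  | nil =>
    rw [mono_leadExp_nil]
    exact apply_mul_eq_zero (pow_apply_eq_zero _ (hD _ (by simp [halves])) _)
      (pow_apply_eq_zero _ (hD _ (by simp [halves])) _)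
  | cons y L ih =>
    rw [mono_leadExp_cons]
    exact apply_mul_eq_zero (apply_mul_eq_zero (pow_apply_eq_zero _ (hD _ (by simp [halves])) _)
      (pow_apply_eq_zero _ (hD _ (by simp [halves])) _)) (ih fun c hc => hD c (by simp [halves, hc]))

omit [CharP K p] [Fact p.Prime] in
theorem weight_leadExp {g : ℕ} (z y₀ : WildFly k (g + 1)) (L : List (WildFly k (g + 1))) :
    Finsupp.weight (letterWeight p (⟨g + 1, z⟩ : WildSpecie k)) (leadExp p y₀ L) = 0 := by
  have h : ∀ (c : WildFly k g) (n : ℕ), Finsupp.weight (letterWeight p (⟨g + 1, z⟩ : WildSpecie k))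
      (Finsupp.single (⟨g, c⟩ : WildSpecie k) n) = 0 := by
    intro c n
    rw [Finsupp.weight_single, letterWeight_of_lt p _ c (Nat.lt_succ_self g), smul_zero]
  induction L with
  | nil => rw [leadExp, map_add, h, h, add_zero]
  | cons y L ih => rw [leadExp, map_add, map_add, h, h, ih, add_zero, add_zero]

theorem fst_mem_halves {g : ℕ} (y₀ : WildFly k (g + 1)) {L : List (WildFly k (g + 1))}
    {z : WildFly k (g + 1)} (hz : z = y₀ ∨ z ∈ L) : z.fst ∈ halves y₀ L := by
  induction L with
  | nil =>
    rcases hz with rfl | hz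
    · simp [halves]
    · simp at hz
  | cons y L ih =>
    rw [List.mem_cons] at hz
    rcases hz with hz | rfl | hz
    · simp [halves, ih (Or.inl hz)]
    · simp [halves]
    · simp [halves, ih (Or.inr hz)]

/-- The leading term of a commutator of pivot elements of different flies. -/
theorem exists_chain_eq {g : ℕ} (y₀ : WildFly k (g + 1)) (L : List (WildFly k (g + 1)))
    (hL : (halves y₀ L).Nodup) :
    ∃ B ∈ offDegree p K {x | ∃ z : WildFly k (g + 1), (z = y₀ ∨ z ∈ L) ∧ x = ⟨g + 1, z⟩},
      chain p K (L.map fun y => y.fst) ⁅pivot p K y₀.fst, pivot p K y₀.snd⁆ =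
        mono p K (leadExp p y₀ L) • chain p K L (pivot p K y₀) + B := by
  have hp : 2 ≤ p := (Fact.out : p.Prime).two_le
  induction L with
  | nil =>
    obtain ⟨H, hH, hb⟩ := exists_pivot_eq (p := p) (K := K) y₀
    refine ⟨⁅H, pivot p K y₀.snd⁆, ?_, ?_⟩
    · refine mem_offDegree (y := (⟨g + 1, y₀⟩ : WildSpecie k))
        (by exact ⟨y₀, Or.inl rfl, rfl⟩) ?_
      have := hH.lie (isHom_pivot_letter (p := p) (K := K) y₀ y₀.snd (Ne.symm y₀.fst_ne_snd))
      rwa [zero_add] at this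
    · have h1 : ⁅pivot p K y₀, flyPd p K y₀.snd⁆ = 0 :=
        der_lie_eq_zero_symm (lie_flyPd_pivot _ _ (Nat.lt_succ_self g))
      rw [mono_leadExp_nil]
      exact der_lie_leading hp hb (pivot_eq p K y₀.snd) (pivot_flyVar_ne _ _ y₀.fst_ne_snd)
        (pivot_flyVar_self _) h1 (pivot_flyVar_of_lt _ _ (Nat.lt_succ_self g)) (t_pow_p _)
  | cons y L ih =>
    rw [halves, List.nodup_cons, List.nodup_cons] at hL
    obtain ⟨ha, hd, hL⟩ := hL
    have hne : ∀ z : WildFly k (g + 1), (z = y₀ ∨ z ∈ L) → y.fst ≠ z.fst := by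
      intro z hz h
      exact ha (List.mem_cons_of_mem _ (h ▸ fst_mem_halves y₀ hz))
    obtain ⟨B, hB, hE⟩ := ih hL
    obtain ⟨H, hH, hb⟩ := exists_pivot_eq (p := p) (K := K) y
    set Y := chain p K L (pivot p K y₀) with hY
    -- Old errors stay off-degree because v_{y.fst} has degree zero in all the earlier flies. The
    -- new error is off-degree in `y`, which occurs neither in `H` nor in `Y`.
    refine ⟨⁅pivot p K y.fst, B⁆ + mono p K (leadExp p y₀ L) • ⁅H, Y⁆, add_mem ?_ ?_, ?_⟩
    · refine offDegree_mono (fun x hx => ?_) (lie_mem_offDegree (fun x hx => ?_) hB)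
      · obtain ⟨z, hz, rfl⟩ := hx
        exact ⟨z, hz.imp_right (List.mem_cons_of_mem _), rfl⟩
      · obtain ⟨z, hz, rfl⟩ := hx
        exact isHom_pivot_letter z _ (hne z hz)
    · refine mem_offDegree (y := (⟨g + 1, y⟩ : WildSpecie k))
        (by exact ⟨y, Or.inr List.mem_cons_self, rfl⟩) ?_
      have hY0 : IsHom (letterWeight p (⟨g + 1, y⟩ : WildSpecie k)) 0 Y := by
        have := isHom_chain_letter (p := p) (K := K) y L y₀
        rwa [List.count_eq_zero_of_not_mem, Nat.cast_zero] at this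
        intro hmem
        rw [List.mem_append, List.mem_singleton] at hmem
        exact hne y hmem.symm rfl
      have := IsHom.mul_smul (mono_mem_hom (letterWeight p (⟨g + 1, y⟩ : WildSpecie k))
        (leadExp p y₀ L)) (hH.lie hY0)
      rwa [weight_leadExp, add_zero, sub_zero] at this
    · change ⁅pivot p K y.fst, chain p K (L.map fun y => y.fst) _⁆ = _ • ⁅pivot p K y, Y⁆ + _
      have h1 : pivot p K y.fst (mono p K (leadExp p y₀ L)) = 0 :=
        apply_mono_leadExp y₀ L fun c hc => pivot_flyVar_ne _ _ fun h =>
          ha (List.mem_cons_of_mem _ (h ▸ hc))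
      have h2 : Y (flyVar p K y.fst ^ (p - 1) * flyVar p K y.snd ^ (p - 1)) = 0 := by
        have h3 : ∀ c : WildFly k g, Y (flyVar p K c) = 0 := fun c =>
          chain_apply_eq_zero L (fun a => pivot_flyVar_of_lt _ _ (Nat.lt_succ_self g))
            (pivot_flyVar_of_lt _ _ (Nat.lt_succ_self g))
        exact apply_mul_eq_zero (pow_apply_eq_zero _ (h3 _) _) (pow_apply_eq_zero _ (h3 _) _)
      rw [hE, mono_leadExp_cons]
      exact der_lie_smul_add hb h1 h2

/-- Partners are chosen greedily; `e` holds first halves already committed, which later partners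
must avoid. The cardinality bound leaves at least one free fly at each step. -/
theorem exists_halves {g : ℕ} (y₀ : WildFly k (g + 1)) (l : List (WildFly k g)) :
    ∀ e : List (WildFly k g), (e ++ (l ++ [y₀.fst, y₀.snd])).Nodup →
      e.length + 2 * l.length + 2 ≤ Fintype.card (WildFly k g) →
      ∃ L : List (WildFly k (g + 1)), L.map (fun y => y.fst) = l ∧ (e ++ halves y₀ L).Nodup := by
  induction l with
  | nil => intro e h _; exact ⟨[], rfl, h⟩
  | cons a l ih =>
    intro e h hc
    obtain ⟨L, rfl, hL⟩ := ih (a :: e)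
      (by
        have : (e ++ a :: (l ++ [y₀.fst, y₀.snd])).Perm (a :: (e ++ (l ++ [y₀.fst, y₀.snd]))) :=
          List.perm_middle
        exact this.nodup_iff.mp h)
      (by simp only [List.length_cons] at hc ⊢; omega)
    have hlen : ∀ L : List (WildFly k (g + 1)), (halves y₀ L).length = 2 * L.length + 2 := by
      intro L
      induction L with
      | nil => rfl
      | cons y L ih => simp only [halves, List.length_cons, ih]; omega
    obtain ⟨d, hd⟩ : ∃ d, d ∉ (a :: e ++ halves y₀ L) := by
      by_contra! hall
      have h1 : Fintype.card (WildFly k g) ≤ (a :: e ++ halves y₀ L).length := by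
        have h2 : (Finset.univ : Finset (WildFly k g)) ⊆ (a :: e ++ halves y₀ L).toFinset :=
          fun x _ => List.mem_toFinset.mpr (hall x)
        exact (Finset.card_le_card h2).trans (List.toFinset_card_le _)
      simp only [List.length_cons, List.length_append, hlen, List.length_map] at h1 hc
      omega
    have had : a ≠ d := by
      rintro rfl
      exact hd (by simp)
    refine ⟨a.child d had :: L, rfl, ?_⟩
    have h1 : (e ++ a :: d :: halves y₀ L).Perm (d :: (a :: e ++ halves y₀ L)) := by
      refine List.perm_middle.trans (((List.Perm.cons a List.perm_middle)).trans ?_)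
      exact List.Perm.swap _ _ _
    exact h1.nodup_iff.mpr (List.nodup_cons.mpr ⟨hd, hL⟩)

theorem card_succ (k n : ℕ) : Fintype.card (WildFly k (n + 1)) =
    Fintype.card (WildFly k n) * (Fintype.card (WildFly k n) - 1) := by
  have h : Fintype.card {ab : WildFly k n × WildFly k n // ab.1 ≠ ab.2} =
      Fintype.card (WildFly k n) * Fintype.card (WildFly k n) - Fintype.card (WildFly k n) := by
    rw [Fintype.card_subtype, ← Finset.card_univ, ← Finset.offDiag_card]
    congr 1
    ext x
    simp
  rw [Nat.mul_sub_one, ← h]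
  exact Fintype.card_congr' rfl

theorem three_le_card {k : ℕ} (hk : 3 ≤ k) (n : ℕ) : 3 ≤ Fintype.card (WildFly k n) := by
  induction n with
  | zero => exact hk.trans_eq (Fintype.card_fin k).symm
  | succ n ih =>
    rw [card_succ]
    have : 2 ≤ Fintype.card (WildFly k n) - 1 := by omega
    nlinarith

theorem rightNormed_pivot_ne_zero (hk : 3 ≤ k) (n : ℕ) : ∀ {g : ℕ} (l : List (WildFly k g)),
    l.length = n → l ≠ [] → l.Nodup → 2 * l.length ≤ Fintype.card (WildFly k g) →
    rightNormed (l.map (pivot p K)) ≠ 0 := by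
  have hp : 2 ≤ p := (Fact.out : p.Prime).two_le
  induction n with
  | zero => intro g l h h'; exact absurd (List.length_eq_zero_iff.mp h) h'
  | succ n ih =>
    intro g l hl hne hnd hcard h0
    obtain ⟨l, c, rfl⟩ := List.eq_nil_or_concat'  l |>.resolve_left hne
    rcases List.eq_nil_or_concat' l with rfl | ⟨l, b, rfl⟩
    -- A single pivot takes the value 1 at its own variable.
    · have h1 : pivot p K c = 0 := h0
      have h2 := pivot_flyVar_self (p := p) (K := K) c
      rw [h1] at h2
      exact one_ne_zero' (Nat.zero_lt_of_lt hp) h2.symm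
    · have hnd' : (l ++ [b, c]).Nodup := by simpa using hnd
      have hbc : b ≠ c := by
        have := (List.nodup_append.mp hnd').2.1
        simpa using this
      set y₀ : WildFly k (g + 1) := b.child c hbc with hy₀
      simp only [List.length_append, List.length_singleton] at hl hcard
      obtain ⟨L, rfl, hL⟩ := exists_halves y₀ l [] hnd' (by simp only [List.length_nil]; omega)
      rw [List.nil_append] at hL
      obtain ⟨B, hB, hE⟩ := exists_chain_eq (p := p) (K := K) y₀ L hL
      rw [List.length_map] at hl hcard
      have hndL : (L ++ [y₀]).Nodup := by
        have : ((L ++ [y₀]).map fun y => y.fst).Nodup := by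
          have h3 : ((L ++ [y₀]).map fun y => y.fst) = L.map (fun y => y.fst) ++ [b] := by
            rw [List.map_append]; rfl
          rw [h3]
          exact (List.nodup_append.mp hnd).1
        exact this.of_map
      -- The letters b and c merge into one, so the list is one shorter, while the next generation
      -- is at least twice as large.
      have hYne := ih (L ++ [y₀]) (by simp; omega) (by simp) hndL (by
        rw [card_succ]
        have h3 := three_le_card hk g
        have h4 : 2 ≤ Fintype.card (WildFly k g) - 1 := by omega
        have : Fintype.card (WildFly k g) * 2 ≤
          Fintype.card (WildFly k g) * (Fintype.card (WildFly k g) - 1) := by gcongr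
        simp only [List.length_append, List.length_singleton]
        omega)
      rw [rightNormed_pivot_concat] at hYne
      obtain ⟨x, α, hα, hc⟩ := exists_coeff_apply_ne_zero hYne
      -- The shorter commutator involves no variable of generation g, so adding the leading exponent
      -- to α keeps all exponents below p.
      have hαg : ∀ c : WildFly k g, α ⟨g, c⟩ = 0 := by
        intro c'
        have hx : x.1 = g + 1 + (x.1 - (g + 1)) := by
          by_contra hx
          refine hc ?_
          rw [show chain p K L (pivot p K y₀) (t p K x) = 0 from chain_apply_eq_zero L
            (fun a => pivot_flyVar_of_lt a x.2 (by omega))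
            (pivot_flyVar_of_lt y₀ x.2 (by omega)), map_zero]
        exact coeff_support_of_isHom (isHom_chain_low le_rfl L (isHom_pivot_low y₀ le_rfl)) hc
          (by omega) (⟨g, c'⟩ : WildSpecie k) (Nat.lt_succ_self g)
      have hlt : ∀ a, (leadExp p y₀ L + α) a < p := by
        rintro ⟨m, a⟩
        rw [Finsupp.add_apply]
        by_cases hm : m = g
        · subst hm
          rw [hαg, add_zero]
          have h3 := leadExp_le p y₀ L a
          have h4 := List.nodup_iff_count_le_one.mp hL a
          have h5 : (p - 1) * (halves y₀ L).count a ≤ (p - 1) * 1 := by gcongr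
          omega
        · rw [leadExp_of_ne _ _ _ _ hm, zero_add]
          exact hα _
      -- The shorter commutator is multilinear, hence of degree one in each of its flies, and the
      -- leading monomial has degree zero in them.
      have hB0 := coeff_offDegree hB hlt (x := x) (by
        rintro _ ⟨z, hz, rfl⟩
        rw [map_add, weight_leadExp, zero_add, (isHom_chain_letter z L y₀).weight_eq hc,
          List.count_eq_one_of_mem hndL (by simpa [or_comm] using hz)]
        simp)
      have h6 : rightNormed (((L.map (fun y => y.fst) ++ [b]) ++ [c]).map (pivot p K)) =
          chain p K (L.map fun y => y.fst) ⁅pivot p K y₀.fst, pivot p K y₀.snd⁆ := by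
        rw [rightNormed_pivot_concat, chain, List.foldr_append]
        rfl
      rw [h6, hE] at h0
      have h7 := congrArg (fun D => coeff (leadExp p y₀ L + α) hlt (D (t p K x))) h0
      simp only [Derivation.add_apply, map_add, hB0, add_zero, Derivation.zero_apply, map_zero,
        Derivation.smul_apply, smul_eq_mul, coeff_add_mono_mul _ _ hα hlt] at h7
      exact hc h7

end WildFly

end

noncomputable section

/-! ## Iterated commutators in characteristic `p` -/

section Abstract

variable {K A : Type*} [Field K] [CommRing A] [Algebra K A]

/-- The iterated commutator `(ad D)^j E`. -/
def adIter (D : Derivation K A A) (j : ℕ) (E : Derivation K A A) : Derivation K A A :=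
  (fun E => ⁅D, E⁆)^[j] E

theorem adIter_zero (D E : Derivation K A A) : adIter D 0 E = E := rfl

theorem adIter_succ (D : Derivation K A A) (j : ℕ) (E : Derivation K A A) :
    adIter D (j + 1) E = ⁅D, adIter D j E⁆ := Function.iterate_succ_apply' _ _ _

theorem adIter_succ' (D : Derivation K A A) (j : ℕ) (E : Derivation K A A) :
    adIter D (j + 1) E = adIter D j ⁅D, E⁆ := Function.iterate_succ_apply _ _ _

theorem adIter_add (D : Derivation K A A) (j : ℕ) (E F : Derivation K A A) :
    adIter D j (E + F) = adIter D j E + adIter D j F := by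
  induction j with
  | zero => rfl
  | succ j ih => rw [adIter_succ, adIter_succ, adIter_succ, ih, lie_add]

/-- The derivation `Z` does not involve the variable `s` with partial derivation `d`. -/
def FreeOf (d : Derivation K A A) (s : A) (Z : Derivation K A A) : Prop := ⁅d, Z⁆ = 0 ∧ Z s = 0

theorem FreeOf.add {d Z Z' : Derivation K A A} {s : A} (h : FreeOf d s Z) (h' : FreeOf d s Z') :
    FreeOf d s (Z + Z') :=
  ⟨by rw [lie_add, h.1, h'.1, add_zero], by rw [Derivation.add_apply, h.2, h'.2, add_zero]⟩

theorem FreeOf.sum {ι : Type*} {d : Derivation K A A} {s : A} {S : Finset ι}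
    {F : ι → Derivation K A A} (h : ∀ i ∈ S, FreeOf d s (F i)) : FreeOf d s (∑ i ∈ S, F i) := by
  classical
  induction S using Finset.induction_on with
  | empty => exact ⟨lie_zero _, rfl⟩
  | insert i S hi ih =>
    rw [Finset.sum_insert hi]
    exact (h i (Finset.mem_insert_self _ _)).add
      (ih fun j hj => h j (Finset.mem_insert_of_mem hj))

theorem FreeOf.smul {d Z : Derivation K A A} {s f : A} (hf : d f = 0) (h : FreeOf d s Z) :
    FreeOf d s (f • Z) :=
  ⟨by rw [der_lie_smul_of_eq_zero hf, h.1, smul_zero],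
    by rw [Derivation.smul_apply, h.2, smul_zero]⟩

theorem FreeOf.lie {d Z Z' : Derivation K A A} {s : A} (h : FreeOf d s Z) (h' : FreeOf d s Z') :
    FreeOf d s ⁅Z, Z'⁆ :=
  ⟨by rw [leibniz_lie, h.1, h'.1, zero_lie, lie_zero, add_zero], der_lie_apply_eq_zero h.2 h'.2⟩

variable {p : ℕ} {d u Z D : Derivation K A A} {s : A}

theorem lie_of_freeOf (hD : D = d + s ^ (p - 1) • u) (hZ : FreeOf d s Z) :
    ⁅D, Z⁆ = s ^ (p - 1) • ⁅u, Z⁆ := by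
  have h : Z (s ^ (p - 1)) = 0 := by rw [Derivation.leibniz_pow, hZ.2, smul_zero, smul_zero]
  rw [hD, add_lie, hZ.1, zero_add, der_smul_lie, h, zero_smul, sub_zero]

/-- On multiples of s, ad D is just differentiation in s: the part s^(p-1) u contributes a power of
s that is at least p. -/
theorem lie_pow_smul_of_freeOf (hD : D = d + s ^ (p - 1) • u) (hu : FreeOf d s u)
    (hZ : FreeOf d s Z) (hd : d s = 1) (hs : s ^ p = 0) {i : ℕ} (hi : 1 ≤ i) :
    ⁅D, s ^ i • Z⁆ = i • s ^ (i - 1) • Z := by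
  have h1 : D s = 1 := by
    rw [hD, Derivation.add_apply, Derivation.smul_apply, hd, hu.2, smul_zero, add_zero]
  have h2 : s ^ i * s ^ (p - 1) = 0 := by
    rw [← pow_add]; exact pow_eq_zero_of_le (by omega) hs
  rw [der_lie_smul, lie_of_freeOf hD hZ, smul_smul, h2, zero_smul, zero_add, Derivation.leibniz_pow,
    h1, smul_eq_mul, mul_one, smul_assoc]

theorem adIter_pow_smul (hD : D = d + s ^ (p - 1) • u) (hu : FreeOf d s u)
    (hZ : FreeOf d s Z) (hd : d s = 1) (hs : s ^ p = 0) {j : ℕ} (hj : j ≤ p - 1) :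
    adIter D j (s ^ (p - 1) • Z) = (p - 1).descFactorial j • s ^ (p - 1 - j) • Z := by
  induction j with
  | zero => rw [adIter_zero, Nat.descFactorial_zero, one_smul, Nat.sub_zero]
  | succ j ih =>
    rw [adIter_succ, ih (by omega), lie_nsmul,
      lie_pow_smul_of_freeOf hD hu hZ hd hs (by omega), Nat.descFactorial_succ, mul_comm,
      mul_smul, show p - 1 - j - 1 = p - 1 - (j + 1) by omega]

/-- Wilson's theorem, carried from `ZMod p` to `K`. -/
theorem factorial_smul [hp : Fact p.Prime] [CharP K p] (Z : Derivation K A A) :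
    (p - 1).factorial • Z = -Z := by
  have h : (((p - 1).factorial : ℕ) : K) = -1 := by
    have := congrArg (ZMod.castHom (dvd_refl p) K) (ZMod.wilsons_lemma p)
    rwa [map_natCast, map_neg, map_one] at this
  rw [← Nat.cast_smul_eq_nsmul K, h, neg_smul, one_smul]

theorem adIter_pow_smul_full [hp : Fact p.Prime] [CharP K p] (hD : D = d + s ^ (p - 1) • u)
    (hu : FreeOf d s u) (hZ : FreeOf d s Z) (hd : d s = 1) (hs : s ^ p = 0) :
    adIter D (p - 1) (s ^ (p - 1) • Z) = -Z := by
  rw [adIter_pow_smul hD hu hZ hd hs le_rfl, Nat.descFactorial_self, Nat.sub_self, pow_zero,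
    one_smul, factorial_smul]

/-- The `p`-th iterate of `ad D` for `D = d + s ^ (p - 1) u` is the adjoint action of `- u`. -/
theorem adIter_p [hp : Fact p.Prime] [CharP K p] (hD : D = d + s ^ (p - 1) • u)
    (hu : FreeOf d s u) {Z' : Derivation K A A} (hZ : FreeOf d s Z) (hZ' : FreeOf d s Z')
    (hd : d s = 1) (hs : s ^ p = 0) :
    adIter D p (Z + s ^ (p - 1) • Z') = -⁅u, Z + s ^ (p - 1) • Z'⁆ := by
  -- The first bracket creates s^(p-1) [u, Z], and the other p - 1 differentiate the power away,
  -- leaving (p-1)! = -1.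
  have h1 : adIter D p Z = -⁅u, Z⁆ := by
    conv_lhs => rw [show p = p - 1 + 1 from (Nat.sub_add_cancel hp.out.one_lt.le).symm]
    rw [adIter_succ', lie_of_freeOf hD hZ, adIter_pow_smul_full hD hu (hu.lie hZ) hd hs]
  -- Here the first p - 1 brackets remove the power of s, and the last one puts it back.
  have h2 : adIter D p (s ^ (p - 1) • Z') = -(s ^ (p - 1) • ⁅u, Z'⁆) := by
    have h3 : adIter D (p - 1 + 1) (s ^ (p - 1) • Z') = -(s ^ (p - 1) • ⁅u, Z'⁆) := by
      rw [adIter_succ, adIter_pow_smul_full hD hu hZ' hd hs, lie_neg, lie_of_freeOf hD hZ']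
    rwa [Nat.sub_add_cancel hp.out.one_lt.le] at h3
  have h4 : u (s ^ (p - 1)) = 0 := by rw [Derivation.leibniz_pow, hu.2, smul_zero, smul_zero]
  rw [adIter_add, h1, h2, lie_add, der_lie_smul_of_eq_zero h4, neg_add]

/-- From Z, the first bracket gives s^(p-1) [u, Z] and only p - 2 differentiations remain, so one
factor s is left over. From s^(p-1) Y all powers are removed. -/
theorem adIter_add_pow_smul [hp : Fact p.Prime] [CharP K p] (hD : D = d + s ^ (p - 1) • u)
    (hu : FreeOf d s u) {Y : Derivation K A A} (hZ : FreeOf d s Z) (hY : FreeOf d s Y)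
    (hd : d s = 1) (hs : s ^ p = 0) :
    ∃ E : Derivation K A A, adIter D (p - 1) (Z + s ^ (p - 1) • Y) = s • E - Y := by
  have hp2 := hp.out.two_le
  refine ⟨(p - 1).descFactorial (p - 2) • ⁅u, Z⁆, ?_⟩
  have h1 : adIter D (p - 2 + 1) Z = (p - 1).descFactorial (p - 2) • s • ⁅u, Z⁆ := by
    rw [adIter_succ', lie_of_freeOf hD hZ, adIter_pow_smul hD hu (hu.lie hZ) hd hs (by omega),
      show p - 1 - (p - 2) = 1 by omega, pow_one]
  rw [show p - 2 + 1 = p - 1 by omega] at h1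
  rw [adIter_add, h1, adIter_pow_smul_full hD hu hY hd hs, smul_comm, sub_eq_add_neg]

/-- The model is a = v_a, b = v_b, s = t_a, r = t_b, y = v_{ab}. The p-th power of ad a is ad(-u),
where u contains r^(p-1) y, so (ad a)^p b = [b, u]. Then p - 2 further brackets with b make p - 1 in
all, which strip r^(p-1) from y. -/
theorem adIter_adIter [hp : Fact p.Prime] [CharP K p] {r : A}
    {a b u' w' d' y y' : Derivation K A A}
    (ha : a = d + s ^ (p - 1) • (u' + r ^ (p - 1) • y))
    (hb : b = d' + r ^ (p - 1) • (w' + s ^ (p - 1) • y'))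
    (hu' : FreeOf d s u') (hy : FreeOf d s y) (hw' : FreeOf d s w') (hy' : FreeOf d s y')
    (hu'r : FreeOf d' r u') (hyr : FreeOf d' r y) (hw'r : FreeOf d' r w') (hy'r : FreeOf d' r y')
    (hdd' : FreeOf d s d') (hdr : d r = 0) (hds : d s = 1) (hd'r : d' r = 1) (hd's : d' s = 0)
    (hs : s ^ p = 0) (hr : r ^ p = 0) :
    ∃ E : Derivation K A A, adIter b (p - 2) (adIter a p b) = r • E - y := by
  have hp2 := hp.out.two_le
  have hdr' : d (r ^ (p - 1)) = 0 := by rw [Derivation.leibniz_pow, hdr, smul_zero, smul_zero]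
  have hd's' : d' (s ^ (p - 1)) = 0 := by rw [Derivation.leibniz_pow, hd's, smul_zero, smul_zero]
  set u := u' + r ^ (p - 1) • y with hu
  have huf : FreeOf d s u := hu'.add (hy.smul hdr')
  have hbe : b = (d' + r ^ (p - 1) • w') + s ^ (p - 1) • (r ^ (p - 1) • y') := by
    rw [hb, smul_add, smul_smul, smul_smul, mul_comm, add_assoc]
  have h1 : adIter a p b = ⁅b, u⁆ := by
    have := adIter_p ha huf (hdd'.add (hw'.smul hdr')) (hy'.smul hdr') hds hs
    rw [← hbe] at this
    rw [this, lie_skew]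
  rw [h1, ← adIter_succ', show p - 2 + 1 = p - 1 by omega, hu]
  exact adIter_add_pow_smul hb (hw'r.add (hy'r.smul hd's')) hu'r hyr hd'r hr

/-! ### Congruence of derivations modulo an ideal -/

/-- The derivation `D` maps the ideal `I` to itself. -/
def Preserves (I : Ideal A) (D : Derivation K A A) : Prop := ∀ f ∈ I, D f ∈ I

/-- The derivations `D` and `E` agree modulo the ideal `I`. -/
def CongMod (I : Ideal A) (D E : Derivation K A A) : Prop := ∀ f, D f - E f ∈ I

variable {I : Ideal A} {D' E E' : Derivation K A A}

theorem CongMod.refl (I : Ideal A) (D : Derivation K A A) : CongMod I D D := fun f => by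
  rw [sub_self]; exact I.zero_mem

theorem Preserves.lie (hD : Preserves I D) (hE : Preserves I E) : Preserves I ⁅D, E⁆ :=
  fun f hf => by
    rw [Derivation.commutator_apply]
    exact I.sub_mem (hD _ (hE f hf)) (hE _ (hD f hf))

/-- The difference is D(E - E') + (D - D')E' minus the same with the roles exchanged. Hence only D
and E need to preserve the ideal, not D' and E'. -/
theorem CongMod.lie (hD : Preserves I D) (hE : Preserves I E) (h : CongMod I D D')
    (h' : CongMod I E E') : CongMod I ⁅D, E⁆ ⁅D', E'⁆ := fun f => by
  rw [Derivation.commutator_apply, Derivation.commutator_apply]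
  have h1 := I.add_mem (hD _ (h' f)) (h (E' f))
  have h2 := I.add_mem (hE _ (h f)) (h' (D' f))
  have := I.sub_mem h1 h2
  rw [map_sub, map_sub] at this
  convert this using 1
  ring

theorem preserves_adIter (hD : Preserves I D) (hE : Preserves I E) (j : ℕ) :
    Preserves I (adIter D j E) := by
  induction j with
  | zero => exact hE
  | succ j ih => rw [adIter_succ]; exact hD.lie ih

theorem congMod_adIter (hD : Preserves I D) (hE : Preserves I E) (h : CongMod I D D')
    (h' : CongMod I E E') (j : ℕ) : CongMod I (adIter D j E) (adIter D' j E') := by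
  induction j with
  | zero => exact h'
  | succ j ih =>
    rw [adIter_succ, adIter_succ]
    exact h.lie hD (preserves_adIter hD hE j) ih

theorem congMod_rightNormed {ι : Type*} {F G : ι → Derivation K A A} (hF : ∀ i, Preserves I (F i))
    (h : ∀ i, CongMod I (F i) (G i)) (l : List ι) :
    Preserves I (rightNormed (l.map F)) ∧
      CongMod I (rightNormed (l.map F)) (rightNormed (l.map G)) := by
  induction l with
  | nil => exact ⟨fun f _ => I.zero_mem, CongMod.refl I 0⟩
  | cons i l ih =>
    rcases eq_or_ne l [] with rfl | hl
    · exact ⟨hF i, h i⟩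
    · rw [List.map_cons, List.map_cons, rightNormed_cons _ (by simpa using hl),
        rightNormed_cons _ (by simpa using hl)]
      exact ⟨(hF i).lie ih.1, (h i).lie (hF i) ih.1 ih.2⟩

end Abstract

/-! ## Right-normed commutators of given length -/

section CommSpan

variable {K L : Type*} [Field K] [LieRing L] [LieAlgebra K L]

/-- The span of the right-normed commutators of length `n` in the elements of `X`. -/
def commSpan (K : Type*) {L : Type*} [Field K] [LieRing L] [LieAlgebra K L] (X : Set L) (n : ℕ) :
    Submodule K L :=
  Submodule.span K {y | ∃ l : List L, l ≠ [] ∧ (∀ x ∈ l, x ∈ X) ∧ l.length = n ∧ y = rightNormed l}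

variable {X : Set L}

theorem subset_commSpan {x : L} (hx : x ∈ X) : x ∈ commSpan K X 1 :=
  Submodule.subset_span ⟨[x], by simp, by simpa using hx, rfl, rfl⟩

theorem lie_mem_commSpan_of_mem {x y : L} {n : ℕ} (hx : x ∈ X) (hy : y ∈ commSpan K X n) :
    ⁅x, y⁆ ∈ commSpan K X (1 + n) := by
  induction hy using Submodule.span_induction with
  | zero => rw [lie_zero]; exact zero_mem _
  | add y z _ _ hy hz => rw [lie_add]; exact add_mem hy hz
  | smul c y _ hy => rw [lie_smul]; exact Submodule.smul_mem _ _ hy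
  | mem y hy =>
    obtain ⟨l, hl, hX, rfl, rfl⟩ := hy
    refine Submodule.subset_span ⟨x :: l, by simp, ?_, ?_, (rightNormed_cons x hl).symm⟩
    · intro z hz
      rcases List.mem_cons.mp hz with rfl | hz
      · exact hx
      · exact hX z hz
    · rw [List.length_cons, add_comm]

/-- Induction on the left commutator by the Jacobi identity. -/
theorem lie_mem_commSpan {x y : L} {m n : ℕ} (hx : x ∈ commSpan K X m)
    (hy : y ∈ commSpan K X n) : ⁅x, y⁆ ∈ commSpan K X (m + n) := by
  induction hx using Submodule.span_induction with
  | zero => rw [zero_lie]; exact zero_mem _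
  | add y z _ _ hy hz => rw [add_lie]; exact add_mem hy hz
  | smul c y _ hy => rw [smul_lie]; exact Submodule.smul_mem _ _ hy
  | mem x hx =>
    obtain ⟨l, hl, hX, rfl, rfl⟩ := hx
    induction l generalizing y n with
    | nil => exact absurd rfl hl
    | cons x l ih =>
      rcases eq_or_ne l [] with rfl | hl'
      · exact lie_mem_commSpan_of_mem (hX x (by simp)) hy
      · have hxX : x ∈ X := hX x (by simp)
        have ih' := fun {y : L} {n : ℕ} (hy : y ∈ commSpan K X n) =>
          ih hy hl' fun z hz => hX z (List.mem_cons_of_mem _ hz)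
        rw [rightNormed_cons _ hl', lie_lie, List.length_cons]
        refine sub_mem ?_ ?_
        · have := lie_mem_commSpan_of_mem hxX (ih' hy)
          rwa [← add_assoc, add_comm 1] at this
        · have := ih' (lie_mem_commSpan_of_mem hxX hy)
          rwa [← add_assoc] at this

end CommSpan

theorem adIter_mem_commSpan {K A : Type*} [Field K] [CommRing A] [Algebra K A]
    {X : Set (Derivation K A A)} {D E : Derivation K A A} {m n : ℕ} (hD : D ∈ commSpan K X m)
    (hE : E ∈ commSpan K X n) (j : ℕ) : adIter D j E ∈ commSpan K X (j * m + n) := by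
  induction j with
  | zero => rwa [zero_mul, zero_add]
  | succ j ih =>
    rw [adIter_succ, show (j + 1) * m + n = m + (j * m + n) by ring]
    exact lie_mem_commSpan hD ih

end

noncomputable section

/-! ## Elements of the Lie algebra that are congruent to the pivot elements -/

theorem der_linearIndependent_of_dual {K A ι : Type*} [Field K] [CommRing A] [Algebra K A]
    {F : ι → Derivation K A A}
    (h : ∀ i, ∃ (φ : A →ₗ[K] K) (x : A), φ (F i x) ≠ 0 ∧ ∀ j, j ≠ i → φ (F j x) = 0) :
    LinearIndependent K F := by
  rw [linearIndependent_iff']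
  intro s g hsum i hi
  obtain ⟨φ, x, hne, hz⟩ := h i
  have happ := congrArg (fun D => φ (D x)) hsum
  simp only [der_sum_apply, map_sum, Derivation.smul_apply, map_smul, Derivation.zero_apply,
    map_zero] at happ
  rw [Finset.sum_eq_single_of_mem i hi fun j _ hj => by rw [hz j hj, smul_zero], smul_eq_mul]
    at happ
  exact (mul_eq_zero.mp happ).resolve_right hne

namespace WildFly

open TruncPoly

variable {p k : ℕ} {K : Type*} [Field K] [CharP K p]

/-- The ideal generated by the variables of generation below `m`. -/
def lowIdeal (p k : ℕ) (K : Type*) [Field K] (m : ℕ) : Ideal (WildRing p k K) :=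
  Ideal.span {f | ∃ x : WildSpecie k, x.1 < m ∧ f = t p K x}

omit [CharP K p] in
theorem lowIdeal_mono {m n : ℕ} (h : m ≤ n) : lowIdeal p k K m ≤ lowIdeal p k K n :=
  Ideal.span_mono fun _ ⟨x, hx, he⟩ => ⟨x, hx.trans_le h, he⟩

omit [CharP K p] in
theorem preserves_lowIdeal {m : ℕ} {D : Derivation K (WildRing p k K) (WildRing p k K)}
    (hD : ∀ x : WildSpecie k, x.1 < m → D (t p K x) = 0) : Preserves (lowIdeal p k K m) D := by
  intro f hf
  induction hf using Submodule.span_induction with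
  | mem f hf =>
    obtain ⟨x, hx, rfl⟩ := hf
    rw [hD x hx]
    exact Ideal.zero_mem _
  | zero => rw [map_zero]; exact Ideal.zero_mem _
  | add f g _ _ hf hg => rw [map_add]; exact Ideal.add_mem _ hf hg
  | smul c f hf ih =>
    rw [smul_eq_mul, Derivation.leibniz]
    exact Ideal.add_mem _ (Ideal.mul_mem_left _ _ ih) (Ideal.mul_mem_right _ _ hf)

omit [CharP K p] in
theorem coeff_lowIdeal {m : ℕ} {f : WildRing p k K} (hf : f ∈ lowIdeal p k K m)
    {α : WildSpecie k →₀ ℕ} (hα : ∀ a, α a < p) (h : ∀ x : WildSpecie k, x.1 < m → α x = 0) :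
    coeff α hα f = 0 := by
  induction hf using Submodule.span_induction with
  | mem f hf =>
    obtain ⟨x, hx, rfl⟩ := hf
    rw [← one_mul (t p K x), coeff_mul_t α hα (h x hx)]
  | zero => exact map_zero _
  | add f g _ _ hf hg => rw [map_add, hf, hg, add_zero]
  | smul c f hf ih =>
    -- The induction hypothesis on f does not control multiples of f, so the induction is repeated
    -- with the multiplier left arbitrary.
    clear ih
    induction hf using Submodule.span_induction generalizing c with
    | mem f hf =>
      obtain ⟨x, hx, rfl⟩ := hf
      exact coeff_mul_t α hα (h x hx) c
    | zero => rw [smul_zero]; exact map_zero _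
    | add f g _ _ hf hg => rw [smul_add, map_add, hf, hg, add_zero]
    | smul d f _ ih => rw [smul_smul]; exact ih _

theorem freeOf_pow_smul_pivot {n : ℕ} (c e : WildFly k n) (y : WildFly k (n + 1)) (h : e ≠ c) :
    FreeOf (flyPd p K c) (flyVar p K c) (flyVar p K e ^ (p - 1) • pivot p K y) :=
  FreeOf.smul (pow_apply_eq_zero _ (flyPd_flyVar_ne _ _ (flyVar_ne h)) _)
    ⟨lie_flyPd_pivot _ _ (Nat.lt_succ_self n), pivot_flyVar_of_lt _ _ (Nat.lt_succ_self n)⟩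

theorem freeOf_pivot {n : ℕ} (c : WildFly k n) (y : WildFly k (n + 1)) :
    FreeOf (flyPd p K c) (flyVar p K c) (pivot p K y) :=
  ⟨lie_flyPd_pivot _ _ (Nat.lt_succ_self n), pivot_flyVar_of_lt _ _ (Nat.lt_succ_self n)⟩

theorem exists_pivot_split {n : ℕ} (a b : WildFly k n) (h : a ≠ b) :
    ∃ u, pivot p K a = flyPd p K a + flyVar p K a ^ (p - 1) •
        (u + flyVar p K b ^ (p - 1) • pivot p K (a.child b h)) ∧
      FreeOf (flyPd p K a) (flyVar p K a) u ∧ FreeOf (flyPd p K b) (flyVar p K b) u := by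
  classical
  refine ⟨∑ c ∈ Finset.univ.erase (⟨b, h⟩ : {b // a ≠ b}), flyVar p K c.1 ^ (p - 1) •
    pivot p K (a.child c.1 c.2), ?_, FreeOf.sum fun c _ => ?_, FreeOf.sum fun c hc => ?_⟩
  · rw [Finset.sum_erase_add _ _ (Finset.mem_univ (⟨b, h⟩ : {b // a ≠ b}))]
    exact pivot_eq p K a
  · exact freeOf_pow_smul_pivot a c.1 _ (Ne.symm c.2)
  · refine freeOf_pow_smul_pivot b c.1 _ fun hcb => Finset.ne_of_mem_erase hc (Subtype.ext hcb)

/-- The Lie algebra generated by two pivot elements contains an approximation to the pivot element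
of their child. -/
theorem exists_adIter_pivot [Fact p.Prime] {n : ℕ} (y : WildFly k (n + 1)) :
    ∃ E, adIter (pivot p K y.snd) (p - 2) (adIter (pivot p K y.fst) p (pivot p K y.snd)) =
      flyVar p K y.snd • E - pivot p K y := by
  obtain ⟨u, hu, hua, hub⟩ := exists_pivot_split (p := p) (K := K) y.fst y.snd y.fst_ne_snd
  obtain ⟨w, hw, hwb, hwa⟩ := exists_pivot_split (p := p) (K := K) y.snd y.fst y.fst_ne_snd.symm
  refine adIter_adIter hu hw hua (freeOf_pivot _ _) hwa (freeOf_pivot _ _) hub (freeOf_pivot _ _)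
    hwb (freeOf_pivot _ _) ⟨lie_flyPd_flyPd _ _, ?_⟩ ?_ (flyPd_flyVar_self _) (flyPd_flyVar_self _)
    ?_ (t_pow_p _) (t_pow_p _)
  · exact flyPd_flyVar_ne _ _ (flyVar_ne y.fst_ne_snd)
  · exact flyPd_flyVar_ne _ _ (flyVar_ne y.fst_ne_snd.symm)
  · exact flyPd_flyVar_ne _ _ (flyVar_ne y.fst_ne_snd)

theorem isHom_rightNormed [Fact p.Prime]
    (l : List (Derivation K (WildRing p k K) (WildRing p k K))) (hl : ∀ x ∈ l, x ∈ wildGens p k K) :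
    IsHom (genWeight p k) (l.length : ℤ) (rightNormed l) := by
  have hgen : ∀ x ∈ wildGens p k K, IsHom (genWeight p k) 1 x := by
    rintro _ ⟨i, rfl⟩
    have h : IsHom (genWeight p k) (genWeight p k ⟨0, i⟩) (pivot p K (show WildFly k 0 from i)) :=
      isHom_pivot (compatible_genWeight p k) _ le_rfl
    rwa [show genWeight p k ⟨0, i⟩ = 1 from pow_zero _] at h
  induction l with
  | nil => exact IsHom.zero _ _
  | cons x l ih =>
    rcases eq_or_ne l [] with rfl | h
    · exact hgen x (hl x (by simp))
    · rw [rightNormed_cons _ h, List.length_cons, Nat.cast_succ, add_comm]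
      exact (hgen x (hl x (by simp))).lie (ih fun z hz => hl z (List.mem_cons_of_mem _ hz))

theorem isHom_of_mem_commSpan [Fact p.Prime] {n : ℕ}
    {D : Derivation K (WildRing p k K) (WildRing p k K)}
    (hD : D ∈ commSpan K (wildGens p k K) n) : IsHom (genWeight p k) (n : ℤ) D := by
  induction hD using Submodule.span_induction with
  | zero => exact IsHom.zero _ _
  | add x y _ _ hx hy => exact hx.add hy
  | smul c x _ hx => exact hx.smul c
  | mem x hx =>
    obtain ⟨l, _, hX, rfl, rfl⟩ := hx
    exact isHom_rightNormed l hX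

theorem genWeight_pos (p k : ℕ) [hp : Fact p.Prime] (x : WildSpecie k) : 0 < genWeight p k x := by
  have : (2 : ℤ) ≤ p := by exact_mod_cast hp.out.two_le
  exact pow_pos (by linarith) _

omit [CharP K p] in
-- The value would have negative weight, but all variables have positive weight.
theorem eq_zero_of_isHom_genWeight [Fact p.Prime] {D : Derivation K (WildRing p k K) (WildRing p k K)}
    {e : ℤ} (hD : IsHom (genWeight p k) e D) {x : WildSpecie k} (hx : genWeight p k x < e) :
    D (t p K x) = 0 := by
  by_contra hne
  obtain ⟨α, hα, hc⟩ := exists_coeff_ne_zero hne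
  have h1 := hD.weight_eq hc
  have h2 : 0 ≤ Finsupp.weight (genWeight p k) α := by
    rw [Finsupp.weight_apply]
    exact Finset.sum_nonneg fun i _ => nsmul_nonneg (genWeight_pos p k i).le _
  omega

/-- Elements of length (2p-1)^m even annihilate the generators of the ideal, whose weights are
smaller. -/
theorem preserves_of_mem_commSpan [hp : Fact p.Prime] {m : ℕ}
    {D : Derivation K (WildRing p k K) (WildRing p k K)}
    (hD : D ∈ commSpan K (wildGens p k K) ((2 * p - 1) ^ m)) : Preserves (lowIdeal p k K m) D := by
  refine preserves_lowIdeal fun x hx => eq_zero_of_isHom_genWeight (isHom_of_mem_commSpan hD) ?_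
  have h2 : 2 ≤ p := hp.out.two_le
  have h3 : (((2 * p - 1) ^ m : ℕ) : ℤ) = (2 * (p : ℤ) - 1) ^ m := by
    rw [Nat.cast_pow, Nat.cast_sub (by omega)]
    simp
  rw [h3, genWeight]
  have : (2 : ℤ) ≤ p := by exact_mod_cast h2
  exact pow_lt_pow_right₀ (by linarith) hx

/-- The identity producing v_{ab} is applied to the approximations of the two halves. The error t_b
E lies in the next ideal, since b has generation m. -/
theorem exists_mem_commSpan [hp : Fact p.Prime] {m : ℕ} (a : WildFly k m) :
    ∃ D ∈ commSpan K (wildGens p k K) ((2 * p - 1) ^ m),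
      CongMod (lowIdeal p k K m) D (pivot p K a) := by
  have h2 : 2 ≤ p := hp.out.two_le
  induction m with
  | zero => exact ⟨pivot p K a, subset_commSpan ⟨a, rfl⟩, CongMod.refl _ _⟩
  | succ m ih =>
    obtain ⟨A, hA, hAa⟩ := ih a.fst
    obtain ⟨B, hB, hBb⟩ := ih a.snd
    obtain ⟨E, hE⟩ := exists_adIter_pivot (p := p) (K := K) a
    refine ⟨-adIter B (p - 2) (adIter A p B), ?_, ?_⟩
    · refine Submodule.neg_mem _ ?_
      have := adIter_mem_commSpan hB (adIter_mem_commSpan hA hB p) (p - 2)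
      -- The length is multiplied by (p - 2) + p + 1 = 2p - 1.
      have h3 : (p - 2) * (2 * p - 1) ^ m + (p * (2 * p - 1) ^ m + (2 * p - 1) ^ m) =
          (2 * p - 1) ^ (m + 1) := by
        obtain ⟨q, rfl⟩ := Nat.exists_eq_add_of_le h2
        rw [pow_succ, show 2 + q - 2 = q by omega, show 2 * (2 + q) - 1 = 2 * q + 3 by omega]
        ring
      rwa [h3] at this
    · have hpA := preserves_of_mem_commSpan hA
      have hpB := preserves_of_mem_commSpan hB
      have h4 := congMod_adIter hpB (preserves_adIter hpA hpB p) hBb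
        (congMod_adIter hpA hpB hAa hBb p) (p - 2)
      intro f
      have h5 := lowIdeal_mono (Nat.le_succ m) (h4 f)
      have h6 : flyVar p K a.snd * E f ∈ lowIdeal p k K (m + 1) :=
        Ideal.mul_mem_right _ _ (Ideal.subset_span ⟨⟨m, a.snd⟩, Nat.lt_succ_self m, rfl⟩)
      rw [hE, Derivation.sub_apply, Derivation.smul_apply, smul_eq_mul] at h5
      have h7 := Ideal.neg_mem_iff _ |>.mpr (Ideal.add_mem _ h5 h6)
      rw [Derivation.neg_apply]
      convert h7 using 1
      ring

/-- The multilinear commutators of the approximate pivot elements. -/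
theorem exists_linearIndependent [hp : Fact p.Prime] (hk : 3 ≤ k) (m n : ℕ) (hn : 1 ≤ n)
    (hc : 2 * n ≤ Fintype.card (WildFly k m)) :
    ∃ F : {S : Finset (WildFly k m) // S.card = n} → Derivation K (WildRing p k K) (WildRing p k K),
      (∀ S, F S ∈ commSpan K (wildGens p k K) (n * (2 * p - 1) ^ m)) ∧ LinearIndependent K F := by
  classical
  choose V hV hVc using fun a : WildFly k m => exists_mem_commSpan (p := p) (K := K) a
  have hmem : ∀ l : List (WildFly k m), l ≠ [] →
      rightNormed (l.map V) ∈ commSpan K (wildGens p k K) (l.length * (2 * p - 1) ^ m) := by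
    intro l hl
    induction l with
    | nil => exact absurd rfl hl
    | cons a l ih =>
      rcases eq_or_ne l [] with rfl | hl'
      · rw [List.length_singleton, one_mul]; exact hV a
      · rw [List.map_cons, rightNormed_cons _ (by simpa using hl'), List.length_cons, add_mul,
          one_mul, add_comm]
        exact lie_mem_commSpan (hV a) (ih hl')
  have hlen : ∀ S : {S : Finset (WildFly k m) // S.card = n}, S.1.toList.length = n := fun S => by
    rw [Finset.length_toList, S.2]
  have hnil : ∀ S : {S : Finset (WildFly k m) // S.card = n}, S.1.toList ≠ [] := fun S h => by
    have := hlen S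
    rw [h] at this
    simp at this
    omega
  refine ⟨fun S => rightNormed (S.1.toList.map V), fun S => ?_, ?_⟩
  · have := hmem _ (hnil S)
    rwa [hlen] at this
  · have hcong : ∀ S : {S : Finset (WildFly k m) // S.card = n}, CongMod (lowIdeal p k K m)
        (rightNormed (S.1.toList.map V)) (rightNormed (S.1.toList.map (pivot p K))) := fun S =>
      (congMod_rightNormed (fun a => preserves_of_mem_commSpan (hV a)) hVc _).2
    have hex : ∀ l : List (WildFly k m), l ≠ [] → ∃ l' y, l = l' ++ [y] := fun l hl =>
      (List.eq_nil_or_concat' l).resolve_left hl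
    refine der_linearIndependent_of_dual fun S => ?_
    have hne := rightNormed_pivot_ne_zero (p := p) (K := K) hk n S.1.toList (hlen S) (hnil S)
      S.1.nodup_toList (by rw [hlen]; exact hc)
    obtain ⟨x, α, hα, hco⟩ := exists_coeff_apply_ne_zero hne
    obtain ⟨l, y, hly⟩ := hex _ (hnil S)
    have hx : m ≤ x.1 := by
      by_contra hx
      refine hco ?_
      rw [hly, rightNormed_pivot_concat, show chain p K l (pivot p K y) (t p K x) = 0 from
        chain_apply_eq_zero l (fun a => pivot_flyVar_of_lt a x.2 (by omega))
          (pivot_flyVar_of_lt y x.2 (by omega)), map_zero]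
    -- At a monomial free of low variables the approximations and the true pivots have equal
    -- coefficients.
    have hsupp : ∀ z : WildSpecie k, z.1 < m → α z = 0 := by
      rw [hly, rightNormed_pivot_concat] at hco
      exact fun z hz => coeff_support_of_isHom
        (isHom_chain_low le_rfl l (isHom_pivot_low y le_rfl)) hco hx z hz
    have heq : ∀ S' : {S : Finset (WildFly k m) // S.card = n},
        coeff α hα (rightNormed (S'.1.toList.map V) (t p K x)) =
          coeff α hα (rightNormed (S'.1.toList.map (pivot p K)) (t p K x)) := by
      intro S'
      have := coeff_lowIdeal (hcong S' (t p K x)) hα hsupp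
      rwa [map_sub, sub_eq_zero] at this
    have hzero : ∀ S' : {S : Finset (WildFly k m) // S.card = n}, S' ≠ S →
        coeff α hα (rightNormed (S'.1.toList.map V) (t p K x)) = 0 := by
      intro S' hS'
      rw [heq]
      by_contra hco'
      -- A fly z in S but not in S' separates the two: the degrees in z are one and zero.
      have hns : ¬ S.1 ⊆ S'.1 := fun hsub => hS' (Subtype.ext
        (Finset.eq_of_subset_of_card_le hsub (by rw [S.2, S'.2])).symm)
      obtain ⟨z, hz, hz'⟩ := Finset.not_subset.mp hns
      obtain ⟨l', y', hly'⟩ := hex _ (hnil S')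
      rw [hly', rightNormed_pivot_concat] at hco'
      rw [hly, rightNormed_pivot_concat] at hco
      have h1 := (isHom_chain_letter z l y).weight_eq hco
      have h2 := (isHom_chain_letter z l' y').weight_eq hco'
      rw [← hly, List.count_eq_one_of_mem S.1.nodup_toList (Finset.mem_toList.mpr hz)] at h1
      rw [← hly', List.count_eq_zero_of_not_mem (fun h => hz' (Finset.mem_toList.mp h))] at h2
      rw [h1] at h2
      simp at h2
    exact ⟨coeff α hα, t p K x, by rw [heq]; exact hco, hzero⟩

end WildFly

end

noncomputable section

/-! ## The growth function inside the derivations -/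

section Growth

variable {K A : Type*} [Field K] [CommRing A] [Algebra K A]

/-- The span of the derivations `[x_1, ..., x_s]^(p^j)` with `x_i ∈ X` and `s p^j ≤ n`. -/
def derGrowth (p : ℕ) [Fact p.Prime] [CharP K p] (X : Set (Derivation K A A)) (n : ℕ) :
    Submodule K (Derivation K A A) :=
  Submodule.span K {y | ∃ (l : List (Derivation K A A)) (j : ℕ), l ≠ [] ∧ (∀ x ∈ l, x ∈ X) ∧
    l.length * p ^ j ≤ n ∧ y = (derPMap p)^[j] (rightNormed l)}

variable {p : ℕ} [Fact p.Prime] [CharP K p]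

theorem coe_rightNormed {X : Set (Derivation K A A)} (l : List (lieP p X)) :
    ((rightNormed l : lieP p X) : Derivation K A A) =
      rightNormed (l.map fun x : lieP p X => (x : Derivation K A A)) := by
  induction l with
  | nil => rfl
  | cons x l ih =>
    rcases eq_or_ne l [] with rfl | hl
    · rfl
    · rw [List.map_cons, rightNormed_cons _ hl, rightNormed_cons _ (mt List.map_eq_nil_iff.mp hl),
        LieSubalgebra.coe_bracket, ih]

theorem coe_liePMap_iterate {X : Set (Derivation K A A)} (j : ℕ) (x : lieP p X) :
    (((liePMap p X)^[j] x : lieP p X) : Derivation K A A) = (derPMap p)^[j] x := by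
  induction j with
  | zero => rfl
  | succ j ih =>
    rw [Function.iterate_succ_apply', Function.iterate_succ_apply', ← ih]
    rfl

theorem growthFunction_eq_finrank (X : Set (Derivation K A A)) (n : ℕ) :
    growthFunction p K (L := lieP p X) (liePMap p X) {x | (x : Derivation K A A) ∈ X} n =
      Module.finrank K (derGrowth p X n) := by
  have h : (growthSpace p K (L := lieP p X) (liePMap p X)
      {x | (x : Derivation K A A) ∈ X} n).map (lieP p X).toSubmodule.subtype = derGrowth p X n := by
    rw [growthSpace, Submodule.map_span, derGrowth]
    congr 1
    ext y
    constructor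
    · rintro ⟨_, ⟨l, j, hl, hX, hn, rfl⟩, rfl⟩
      refine ⟨l.map fun x : lieP p X => (x : Derivation K A A), j, mt List.map_eq_nil_iff.mp hl, ?_,
        by rwa [List.length_map], ?_⟩
      · intro x hx
        obtain ⟨z, hz, rfl⟩ := List.mem_map.mp hx
        exact hX z hz
      · rw [← coe_rightNormed, ← coe_liePMap_iterate]
        rfl
    · rintro ⟨l, j, hl, hX, hn, rfl⟩
      have hlift : ∀ x ∈ l, x ∈ lieP p X := fun x hx => subset_lieP p X (hX x hx)
      refine ⟨_, ⟨l.attach.map fun x => ⟨x.1, hlift x.1 x.2⟩, j, by simpa using hl, ?_,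
        by simpa using hn, rfl⟩, ?_⟩
      · intro x hx
        obtain ⟨z, _, rfl⟩ := List.mem_map.mp hx
        exact hX z.1 z.2
      · change (((liePMap p X)^[j] _ : lieP p X) : Derivation K A A) = _
        rw [coe_liePMap_iterate, coe_rightNormed, List.map_map]
        congr 2
        exact l.attach_map_subtype_val
  rw [growthFunction, ← h]
  exact (Submodule.equivMapOfInjective _ (Submodule.injective_subtype _) _).finrank_eq

theorem commSpan_le_derGrowth {X : Set (Derivation K A A)} {m n : ℕ} (h : m ≤ n) :
    commSpan K X m ≤ derGrowth p X n := by
  refine Submodule.span_mono ?_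
  rintro y ⟨l, hl, hX, rfl, rfl⟩
  exact ⟨l, 0, hl, hX, by rwa [pow_zero, mul_one], rfl⟩

/-- Finiteness is essential: `finrank` is zero on an infinite-dimensional space. -/
theorem card_le_finrank_derGrowth {X : Set (Derivation K A A)} {m n : ℕ} (h : m ≤ n)
    [Module.Finite K (derGrowth p X n)] {ι : Type*} [Fintype ι] {F : ι → Derivation K A A}
    (hF : ∀ i, F i ∈ commSpan K X m) (hli : LinearIndependent K F) :
    Fintype.card ι ≤ Module.finrank K (derGrowth p X n) := by
  have hli' : LinearIndependent K fun i => (⟨F i, commSpan_le_derGrowth h (hF i)⟩ :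
      derGrowth p X n) :=
    LinearIndependent.of_comp (derGrowth p X n).subtype hli
  exact hli'.fintype_card_le_finrank

end Growth

/-! ## Differential operators -/

section Operators

variable {K A : Type*} [Field K] [CommRing A] [Algebra K A]

/-- A derivation as a linear operator. -/
def derToEnd : Derivation K A A →ₗ[K] Module.End K A where
  toFun D := D
  map_add' _ _ := rfl
  map_smul' _ _ := rfl

theorem derToEnd_apply (D : Derivation K A A) (f : A) : derToEnd D f = D f := rfl

theorem derToEnd_injective :
    Function.Injective (derToEnd : Derivation K A A →ₗ[K] Module.End K A) :=
  fun _ _ h => Derivation.ext fun f => LinearMap.congr_fun h f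

theorem derToEnd_lie (D E : Derivation K A A) :
    derToEnd ⁅D, E⁆ = derToEnd D * derToEnd E - derToEnd E * derToEnd D := by
  ext f
  rw [derToEnd_apply, Derivation.commutator_apply]
  rfl

theorem derToEnd_smul (f : A) (D : Derivation K A A) :
    derToEnd (f • D) = Algebra.lmul K A f * derToEnd D := rfl

theorem derToEnd_mul_lmul (f : A) (D : Derivation K A A) :
    derToEnd D * Algebra.lmul K A f = Algebra.lmul K A f * derToEnd D + Algebra.lmul K A (D f) := by
  ext g
  simp only [Module.End.mul_apply, LinearMap.add_apply, derToEnd_apply, Algebra.coe_lmul_eq_mul,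
    LinearMap.mul_apply_apply, Derivation.leibniz, smul_eq_mul]
  ring

theorem derToEnd_derPMap {p : ℕ} [Fact p.Prime] [CharP K p] (j : ℕ) (D : Derivation K A A) :
    derToEnd ((derPMap p)^[j] D) = derToEnd D ^ p ^ j := by
  induction j with
  | zero => rw [pow_zero, pow_one]; rfl
  | succ j ih =>
    rw [Function.iterate_succ_apply', pow_succ, pow_mul, ← ih]
    rfl

theorem commute_derToEnd {D E : Derivation K A A} (h : ⁅D, E⁆ = 0) :
    Commute (derToEnd D) (derToEnd E) := by
  have := derToEnd_lie D E
  rw [h, map_zero] at this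
  exact (sub_eq_zero.mp this.symm)

/-- Variables `x i` with partial derivations `d i`, and derivations `V b` that do not involve
them. -/
structure OperatorSystem {ι B : Type*} [DecidableEq ι] (x : ι → A) (d : ι → Derivation K A A)
    (V : B → Derivation K A A) : Prop where
  d_x : ∀ i j, d i (x j) = if j = i then 1 else 0
  lie_d : ∀ i j, ⁅d i, d j⁆ = 0
  V_x : ∀ b i, V b (x i) = 0
  lie_V_d : ∀ b i, ⁅V b, d i⁆ = 0

namespace OperatorSystem

variable {ι B : Type*} [Fintype ι] [DecidableEq ι] {x : ι → A} {d : ι → Derivation K A A}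
  {V : B → Derivation K A A}

/-- The monomial in the variables `x` with exponent `α`. -/
def xMon (x : ι → A) (α : ι → ℕ) : A := ∏ i, x i ^ α i

omit [DecidableEq ι] in
theorem xMon_add (x : ι → A) (α β : ι → ℕ) : xMon x (α + β) = xMon x α * xMon x β := by
  rw [xMon, xMon, xMon, ← Finset.prod_mul_distrib]
  exact Finset.prod_congr rfl fun i _ => pow_add _ _ _

theorem xMon_single (x : ι → A) (i : ι) (n : ℕ) : xMon x (Pi.single i n) = x i ^ n := by
  rw [xMon, Finset.prod_eq_single i]
  · rw [Pi.single_eq_same]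
  · intro j _ hj
    rw [Pi.single_eq_of_ne hj, pow_zero]
  · intro h
    exact absurd (Finset.mem_univ i) h

omit [Fintype ι] in
theorem single_add_sub {α : ι → ℕ} {i : ι} {n : ℕ} (h : n ≤ α i) :
    Pi.single i n + (α - Pi.single i n) = α := by
  funext j
  rcases eq_or_ne j i with rfl | hj
  · simp [h]
  · simp [hj]

theorem xMon_eq_zero {α : ι → ℕ} {i : ι} {p : ℕ} (hx : x i ^ p = 0) (h : p ≤ α i) :
    xMon x α = 0 := by
  rw [← single_add_sub h, xMon_add, xMon_single, hx, zero_mul]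

theorem d_xMon (S : OperatorSystem x d V) (α : ι → ℕ) (i : ι) :
    d i (xMon x α) = α i • xMon x (α - Pi.single i 1) := by
  have hz : ∀ β : ι → ℕ, β i = 0 → d i (xMon x β) = 0 := by
    intro β hβ
    rw [xMon]
    refine Finset.prod_induction (fun j => x j ^ β j) (fun f => d i f = 0) ?_ ?_ ?_
    · intro f g hf hg
      rw [Derivation.leibniz, hf, hg, smul_zero, smul_zero, add_zero]
    · exact Derivation.map_one_eq_zero _
    · intro j _
      rcases eq_or_ne j i with rfl | hj
      · rw [hβ, pow_zero, Derivation.map_one_eq_zero]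
      · rw [Derivation.leibniz_pow, S.d_x, if_neg hj, smul_zero, smul_zero]
  have h1 := single_add_sub (le_refl (α i))
  set β := α - Pi.single i (α i) with hβ
  have hβi : β i = 0 := by simp [hβ]
  have h2 : d i (xMon x α) = α i • x i ^ (α i - 1) * xMon x β := by
    conv_lhs => rw [← h1]
    rw [xMon_add, xMon_single, Derivation.leibniz, hz β hβi, smul_zero, zero_add,
      Derivation.leibniz_pow, S.d_x, if_pos rfl, smul_eq_mul, smul_eq_mul, mul_one, mul_comm]
  rcases Nat.eq_zero_or_pos (α i) with h0 | h0
  · rw [h2, h0, zero_smul, zero_smul, zero_mul]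
  · have h3 : α - Pi.single i 1 = Pi.single i (α i - 1) + β := by
      funext j
      rcases eq_or_ne j i with rfl | hj
      · simp [hβ]
      · simp [hβ, hj]
    rw [h2, h3, xMon_add, xMon_single, smul_mul_assoc]

omit [Fintype ι] in
theorem pairwise_commute (S : OperatorSystem x d V) :
    Pairwise fun i j => ∀ (a b : Multiplicative ℕ), Commute
      (powersHom (Module.End K A) (derToEnd (d i)) a)
      (powersHom (Module.End K A) (derToEnd (d j)) b) :=
  fun i j _ _ _ => (commute_derToEnd (S.lie_d i j)).pow_pow _ _

/-- The monomial in the partial derivations with exponent `β`. -/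
def dMon (S : OperatorSystem x d V) (β : ι → ℕ) : Module.End K A :=
  MonoidHom.noncommPiCoprod (fun i => powersHom (Module.End K A) (derToEnd (d i)))
    S.pairwise_commute (fun i => Multiplicative.ofAdd (β i))

theorem dMon_add (S : OperatorSystem x d V) (α β : ι → ℕ) :
    S.dMon (α + β) = S.dMon α * S.dMon β := by
  rw [dMon, dMon, dMon, ← map_mul]
  rfl

theorem dMon_zero (S : OperatorSystem x d V) : S.dMon 0 = 1 :=
  map_one (MonoidHom.noncommPiCoprod _ S.pairwise_commute)

theorem dMon_single (S : OperatorSystem x d V) (i : ι) (n : ℕ) :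
    S.dMon (Pi.single i n) = derToEnd (d i) ^ n := by
  rw [dMon]
  have h : (fun j => Multiplicative.ofAdd ((Pi.single i n : ι → ℕ) j)) =
      Pi.mulSingle i (Multiplicative.ofAdd n) := by
    funext j
    rcases eq_or_ne j i with rfl | hj
    · simp
    · simp [hj]
  rw [h, MonoidHom.noncommPiCoprod_mulSingle]
  rfl

theorem dMon_eq_zero (S : OperatorSystem x d V) {β : ι → ℕ} {i : ι} {p : ℕ}
    (hd : derToEnd (d i) ^ p = 0) (h : p ≤ β i) : S.dMon β = 0 := by
  rw [← single_add_sub h, dMon_add, dMon_single, hd, zero_mul]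

theorem commute_dMon (S : OperatorSystem x d V) {T : Module.End K A}
    (h : ∀ i, Commute T (derToEnd (d i))) (β : ι → ℕ) : Commute T (S.dMon β) := by
  rw [dMon, MonoidHom.noncommPiCoprod_apply]
  exact Finset.noncommProd_commute _ _ _ _ fun i _ => (h i).pow_right _

/-- The operator `x^α ∂^β V_{w_1} ... V_{w_s}`. -/
def opMon (S : OperatorSystem x d V) (α β : ι → ℕ) (w : List B) : Module.End K A :=
  Algebra.lmul K A (xMon x α) * S.dMon β * (w.map fun b => derToEnd (V b)).prod

/-- The span of the operators `x^α ∂^β V_{w_1} ... V_{w_s}` of weight `e`. -/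
def opSpan (S : OperatorSystem x d V) (wt : ι → ℤ) (W : ℤ) (e : ℤ) :
    Submodule K (Module.End K A) :=
  Submodule.span K {T | ∃ (α β : ι → ℕ) (w : List B),
    ∑ i, β i * wt i - ∑ i, α i * wt i + w.length * W = e ∧ T = S.opMon α β w}

/-- The operators that raise the weight by `e` under left multiplication. -/
def raising (S : OperatorSystem x d V) (wt : ι → ℤ) (W : ℤ) (e : ℤ) :
    Submodule K (Module.End K A) where
  carrier := {T | ∀ f, ∀ U ∈ S.opSpan wt W f, T * U ∈ S.opSpan wt W (e + f)}
  zero_mem' f U _ := by rw [zero_mul]; exact zero_mem _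
  add_mem' h h' f U hU := by rw [add_mul]; exact add_mem (h f U hU) (h' f U hU)
  smul_mem' c T h f U hU := by rw [smul_mul_assoc]; exact Submodule.smul_mem _ _ (h f U hU)

variable {S : OperatorSystem x d V} {wt : ι → ℤ} {W : ℤ}

/-- Working with left multiplication makes closure under products immediate, so normal ordering only
has to be checked for one factor x_i, d_i or V_b against a basis operator. -/
theorem mem_raising {e : ℤ} {T : Module.End K A}
    (h : ∀ α β w, T * S.opMon α β w ∈
      S.opSpan wt W (e + (∑ i, β i * wt i - ∑ i, α i * wt i + w.length * W))) :
    T ∈ S.raising wt W e := by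
  intro f U hU
  induction hU using Submodule.span_induction with
  | zero => rw [mul_zero]; exact zero_mem _
  | add y z _ _ hy hz => rw [mul_add]; exact add_mem hy hz
  | smul c y _ hy => rw [mul_smul_comm]; exact Submodule.smul_mem _ _ hy
  | mem U hU =>
    obtain ⟨α, β, w, rfl, rfl⟩ := hU
    exact h α β w

theorem mul_mem_raising {e e' : ℤ} {T T' : Module.End K A} (h : T ∈ S.raising wt W e)
    (h' : T' ∈ S.raising wt W e') : T * T' ∈ S.raising wt W (e + e') := by
  intro f U hU
  rw [mul_assoc, add_assoc]
  exact h _ _ (h' f U hU)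

theorem pow_mem_raising {e : ℤ} {T : Module.End K A} (h : T ∈ S.raising wt W e) (n : ℕ) :
    T ^ n ∈ S.raising wt W (n * e) := by
  induction n with
  | zero =>
    intro f U hU
    rwa [pow_zero, one_mul, Nat.cast_zero, zero_mul, zero_add]
  | succ n ih =>
    rw [pow_succ', Nat.cast_succ, add_mul, one_mul, add_comm]
    exact mul_mem_raising h ih

theorem sum_single_mul (wt : ι → ℤ) (i : ι) :
    ∑ j, ((Pi.single i 1 : ι → ℕ) j : ℤ) * wt j = wt i := by
  rw [Finset.sum_eq_single i]
  · simp
  · intro j _ hj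
    simp [hj]
  · intro h
    exact absurd (Finset.mem_univ i) h

omit [DecidableEq ι] in
theorem sum_add_mul (wt : ι → ℤ) (α β : ι → ℕ) : ∑ j, (((α + β : ι → ℕ) j : ℕ) : ℤ) * wt j =
    ∑ j, (α j : ℤ) * wt j + ∑ j, (β j : ℤ) * wt j := by
  rw [← Finset.sum_add_distrib]
  exact Finset.sum_congr rfl fun j _ => by rw [Pi.add_apply]; push_cast; ring

theorem opMon_mem {α β : ι → ℕ} {w : List B} {e : ℤ}
    (h : ∑ i, β i * wt i - ∑ i, α i * wt i + w.length * W = e) :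
    S.opMon α β w ∈ S.opSpan wt W e := Submodule.subset_span ⟨α, β, w, h, rfl⟩

theorem lmul_mem_raising (i : ι) : Algebra.lmul K A (x i) ∈ S.raising wt W (-wt i) := by
  refine mem_raising fun α β w => ?_
  have h : Algebra.lmul K A (x i) * S.opMon α β w = S.opMon (Pi.single i 1 + α) β w := by
    rw [opMon, opMon, xMon_add, xMon_single, pow_one, map_mul]
    simp only [mul_assoc]
  rw [h]
  refine opMon_mem ?_
  rw [sum_add_mul, sum_single_mul]
  ring

/-- Moving d_i past x^α leaves a Leibniz term with one x_i fewer, which has the same weight as one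
d_i more. -/
theorem d_mem_raising (i : ι) : derToEnd (d i) ∈ S.raising wt W (wt i) := by
  refine mem_raising fun α β w => ?_
  have h : derToEnd (d i) * S.opMon α β w = S.opMon α (Pi.single i 1 + β) w +
      α i • S.opMon (α - Pi.single i 1) β w := by
    rw [opMon, opMon, opMon, ← mul_assoc, ← mul_assoc, derToEnd_mul_lmul, S.d_xMon, map_nsmul,
      dMon_add, dMon_single, pow_one]
    simp only [add_mul, mul_assoc, smul_mul_assoc]
  rw [h]
  refine add_mem (opMon_mem ?_) ?_
  · rw [sum_add_mul, sum_single_mul]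
    ring
  -- For α i = 0 the truncated subtraction gives the wrong weight, but the coefficient vanishes.
  · rcases Nat.eq_zero_or_pos (α i) with h0 | h0
    · rw [h0, zero_smul]
      exact zero_mem _
    · refine Submodule.smul_of_tower_mem _ _ (opMon_mem ?_)
      have h1 := congrArg (fun γ : ι → ℕ => ∑ j, (γ j : ℤ) * wt j)
        (single_add_sub (α := α) (i := i) (n := 1) h0)
      simp only [sum_add_mul, sum_single_mul] at h1
      rw [← h1]
      ring

theorem V_mem_raising (b : B) : derToEnd (V b) ∈ S.raising wt W W := by
  refine mem_raising fun α β w => ?_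
  have hz : V b (xMon x α) = 0 := by
    rw [xMon]
    refine Finset.prod_induction (fun j => x j ^ α j) (fun f => V b f = 0) ?_ ?_ ?_
    · intro f g hf hg
      rw [Derivation.leibniz, hf, hg, smul_zero, smul_zero, add_zero]
    · exact Derivation.map_one_eq_zero _
    · intro j _
      rw [Derivation.leibniz_pow, S.V_x, smul_zero, smul_zero]
  have h : derToEnd (V b) * S.opMon α β w = S.opMon α β (b :: w) := by
    have hc : derToEnd (V b) * S.dMon β = S.dMon β * derToEnd (V b) :=
      S.commute_dMon (fun i => commute_derToEnd (S.lie_V_d b i)) β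
    rw [opMon, opMon, ← mul_assoc, ← mul_assoc, derToEnd_mul_lmul, hz, map_zero, add_zero,
      mul_assoc (Algebra.lmul K A _), hc, List.map_cons, List.prod_cons]
    simp only [mul_assoc]
  rw [h]
  refine opMon_mem ?_
  rw [List.length_cons]
  push_cast
  ring

theorem pow_smul_mem_raising (i : ι) (n : ℕ) {D : Derivation K A A} {e : ℤ}
    (hD : derToEnd D ∈ S.raising wt W e) :
    derToEnd (x i ^ n • D) ∈ S.raising wt W (n * -wt i + e) := by
  rw [derToEnd_smul, map_pow]
  exact mul_mem_raising (pow_mem_raising (lmul_mem_raising i) n) hD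

theorem rightNormed_mem_raising {l : List (Derivation K A A)}
    (hl : ∀ D ∈ l, derToEnd D ∈ S.raising wt W 1) :
    derToEnd (rightNormed l) ∈ S.raising wt W l.length := by
  induction l with
  | nil => exact (S.raising wt W _).zero_mem
  | cons D l ih =>
    rcases eq_or_ne l [] with rfl | h
    · exact hl D (by simp)
    · have h1 := hl D (by simp)
      have h2 := ih fun E hE => hl E (List.mem_cons_of_mem _ hE)
      rw [rightNormed_cons _ h, derToEnd_lie, List.length_cons, Nat.cast_succ]
      refine sub_mem ?_ (mul_mem_raising h2 h1)
      rw [add_comm]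
      exact mul_mem_raising h1 h2

/-- Apply the operator to the identity, the empty monomial of weight zero. -/
theorem mem_opSpan_of_mem_raising {e : ℤ} {T : Module.End K A} (h : T ∈ S.raising wt W e) :
    T ∈ S.opSpan wt W e := by
  have h1 : (1 : Module.End K A) ∈ S.opSpan wt W 0 := by
    have : S.opMon 0 0 [] = 1 := by
      have hx : xMon x 0 = 1 := Finset.prod_eq_one fun i _ => pow_zero _
      rw [opMon, dMon_zero, hx, map_one, one_mul, one_mul, List.map_nil, List.prod_nil]
    rw [← this]
    exact opMon_mem (by simp)
  have := h 0 1 h1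
  rwa [mul_one, add_zero] at this

/-- As operators, commutators and their p-th powers are polynomials in the generators, hence
combinations of normal-form operators. Exponents from p on give zero, the weight bounds the word
length, and counting finishes. -/
theorem derGrowth_le [Fintype B] {p : ℕ} [hp : Fact p.Prime] [CharP K p] {X : Set (Derivation K A A)}
    (hX : ∀ D ∈ X, derToEnd D ∈ S.raising wt W 1) (hx : ∀ i, x i ^ p = 0)
    (hd : ∀ i, derToEnd (d i) ^ p = 0) (hwt : ∀ i, 0 ≤ wt i) (hwt' : ∀ i, wt i ≤ W) (hW : 0 < W)
    (hB : 2 ≤ Fintype.card B) {n s : ℕ} (hs : (n : ℤ) < (s - p * Fintype.card ι) * W) :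
    Module.Finite K (derGrowth p X n) ∧ Module.finrank K (derGrowth p X n) ≤
      p ^ (2 * Fintype.card ι) * Fintype.card B ^ s := by
  have hp0 : 0 < p := hp.out.pos
  let T : ((ι → Fin p) × (ι → Fin p)) × (Σ i : Fin s, (Fin i → B)) → Module.End K A := fun z =>
    S.opMon (fun i => z.1.1 i) (fun i => z.1.2 i) (List.ofFn z.2.2)
  have hle : (derGrowth p X n).map derToEnd ≤ Submodule.span K (Set.range T) := by
    rw [derGrowth, Submodule.map_span, Submodule.span_le]
    rintro _ ⟨_, ⟨l, j, hl, hlX, hn, rfl⟩, rfl⟩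
    have h1 := mem_opSpan_of_mem_raising (pow_mem_raising
      (rightNormed_mem_raising (l := l) fun D hD => hX D (hlX D hD)) (p ^ j))
    rw [← derToEnd_derPMap] at h1
    refine (Submodule.span_le.mpr ?_ : S.opSpan wt W _ ≤ _) h1
    rintro _ ⟨α, β, w, hw, rfl⟩
    by_cases hα : ∀ i, α i < p
    swap
    · push Not at hα
      obtain ⟨i, hi⟩ := hα
      rw [opMon, xMon_eq_zero (hx i) hi, map_zero, zero_mul, zero_mul]
      exact zero_mem _
    by_cases hβ : ∀ i, β i < p
    swap
    · push Not at hβ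
      obtain ⟨i, hi⟩ := hβ
      rw [opMon, S.dMon_eq_zero (hd i) hi, mul_zero, zero_mul]
      exact zero_mem _
    -- Each d only adds weight and the variables subtract at most p · |ι| · W, so |w| W ≤ n + p |ι|
    -- W < s W.
    have hlen : w.length < s := by
      have h2 : 0 ≤ ∑ i, (β i : ℤ) * wt i :=
        Finset.sum_nonneg fun i _ => mul_nonneg (Int.natCast_nonneg _) (hwt i)
      have h3 : ∑ i, (α i : ℤ) * wt i ≤ p * Fintype.card ι * W := by
        calc ∑ i, (α i : ℤ) * wt i ≤ ∑ _i : ι, (p : ℤ) * W := by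
              refine Finset.sum_le_sum fun i _ => mul_le_mul ?_ (hwt' i) (hwt i) (by positivity)
              exact_mod_cast (hα i).le
          _ = _ := by rw [Finset.sum_const, Finset.card_univ, nsmul_eq_mul]; ring
      have h4 : ((p ^ j : ℕ) : ℤ) * l.length ≤ n := by
        rw [mul_comm]; exact_mod_cast hn
      have h5 : (w.length : ℤ) * W < s * W := by linarith
      exact_mod_cast lt_of_mul_lt_mul_right h5 hW.le
    refine Submodule.subset_span ⟨((fun i => ⟨α i, hα i⟩, fun i => ⟨β i, hβ i⟩),
      ⟨⟨w.length, hlen⟩, w.get⟩), ?_⟩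
    change S.opMon α β (List.ofFn w.get) = _
    rw [List.ofFn_get]
  have hfin : Module.Finite K (Submodule.span K (Set.range T)) :=
    Module.Finite.span_of_finite K (Set.finite_range T)
  have hfin' : Module.Finite K ((derGrowth p X n).map derToEnd) :=
    Submodule.finiteDimensional_of_le hle
  have e := Submodule.equivMapOfInjective derToEnd derToEnd_injective (derGrowth p X n)
  refine ⟨Module.Finite.equiv e.symm, ?_⟩
  rw [e.finrank_eq]
  refine (Submodule.finrank_mono hle).trans ((finrank_range_le_card T).trans ?_)
  rw [Fintype.card_prod, Fintype.card_prod, Fintype.card_fun, Fintype.card_fin, ← pow_add, ← two_mul,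
    Fintype.card_sigma]
  refine Nat.mul_le_mul_left _ ?_
  simp only [Fintype.card_fun, Fintype.card_fin]
  rw [Fin.sum_univ_eq_sum_range fun i => Fintype.card B ^ i]
  exact (Nat.geomSum_lt hB fun i hi => Finset.mem_range.mp hi).le

end OperatorSystem

end Operators

end

noncomputable section

/-! ## Bounds for the growth function of the wild Lie algebra -/

namespace OperatorSystem

variable {K A : Type*} [Field K] [CommRing A] [Algebra K A] {ι B : Type*} [Fintype ι]
  [DecidableEq ι] {x : ι → A} {d : ι → Derivation K A A} {V : B → Derivation K A A}
  {S : OperatorSystem x d V} {wt : ι → ℤ} {W : ℤ}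

theorem add_pow_smul_sum_mem_raising {β : Type*} [Fintype β] {D : Derivation K A A} {e e' : ℤ}
    (hD : derToEnd D ∈ S.raising wt W e) (n : ℕ) (i : ι) (f : β → ι) {F : β → Derivation K A A}
    (hF : ∀ b, derToEnd (F b) ∈ S.raising wt W e')
    (he : ∀ b, n * -wt i + (n * -wt (f b) + e') = e) :
    derToEnd (D + x i ^ n • ∑ b, x (f b) ^ n • F b) ∈ S.raising wt W e := by
  rw [map_add, Finset.smul_sum, map_sum]
  refine add_mem hD (Submodule.sum_mem _ fun b _ => ?_)
  rw [← he b]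
  exact pow_smul_mem_raising i n (pow_smul_mem_raising (f b) n (hF b))

end OperatorSystem

namespace WildFly

open TruncPoly OperatorSystem

variable {p k : ℕ} {K : Type*} [Field K] [CharP K p]

/-- The flies of generation below `m`. -/
abbrev Low (k m : ℕ) : Type := Σ i : Fin m, WildFly k i

/-- A fly of generation below `m` as a member of the specie. -/
def Low.toSpecie {k m : ℕ} (y : Low k m) : WildSpecie k := ⟨y.1, y.2⟩

theorem Low.toSpecie_injective {k m : ℕ} : Function.Injective (Low.toSpecie (k := k) (m := m)) := by
  rintro ⟨⟨i, hi⟩, a⟩ ⟨⟨j, hj⟩, b⟩ h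
  obtain ⟨h1, h2⟩ := Sigma.mk.inj h
  change i = j at h1
  subst h1
  obtain rfl : a = b := eq_of_heq h2
  rfl

theorem operatorSystem (p : ℕ) {k : ℕ} (K : Type*) [Field K] [CharP K p] (m : ℕ) :
    OperatorSystem (K := K) (A := WildRing p k K) (fun y : Low k m => t p K y.toSpecie)
      (fun y => pd p K y.toSpecie) (fun b : WildFly k m => pivot p K b) where
  d_x i j := by
    rw [pd, mkDer_t]
    by_cases h : j = i
    · rw [if_pos h, if_pos (congrArg _ h)]
    · rw [if_neg h, if_neg fun h' => h (Low.toSpecie_injective h')]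
  lie_d i j := lie_flyPd_flyPd _ _
  V_x b i := by
    rw [pivot_t_of_le b i.toSpecie i.1.2.le, if_neg]
    intro h
    exact i.1.2.ne (congrArg Sigma.fst h)
  lie_V_d b i := der_lie_eq_zero_symm (lie_flyPd_pivot _ _ i.1.2)

/-- Induction on the distance j to generation m; the weights balance because (2p-1) - 2(p-1) = 1. -/
theorem pivot_mem_raising [hp : Fact p.Prime] (m j : ℕ) : ∀ {n : ℕ} (_ : n + j = m)
    (a : WildFly k n), derToEnd (pivot p K a) ∈ (operatorSystem (k := k) p K m).raising
      (fun y => genWeight p k y.toSpecie) ((2 * p - 1) ^ m) ((2 * p - 1) ^ n) := by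
  induction j with
  | zero =>
    intro n h a
    obtain rfl : n = m := h
    exact V_mem_raising (S := operatorSystem (k := k) p K n) a
  | succ j ih =>
    intro n h a
    have hn : n < m := by omega
    rw [pivot_eq]
    refine add_pow_smul_sum_mem_raising (S := operatorSystem (k := k) p K m)
      (d_mem_raising (S := operatorSystem (k := k) p K m) ⟨⟨n, hn⟩, a⟩) (p - 1) ⟨⟨n, hn⟩, a⟩
      (fun b : {b // a ≠ b} => ⟨⟨n, hn⟩, b.1⟩) (e' := (2 * p - 1) ^ (n + 1))
      (fun b => ih (by omega) (a.child b.1 b.2)) fun b => ?_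
    have h1 : ((p - 1 : ℕ) : ℤ) = p - 1 := by
      rw [Nat.cast_sub hp.out.one_lt.le, Nat.cast_one]
    change ((p - 1 : ℕ) : ℤ) * -(2 * p - 1) ^ n + (((p - 1 : ℕ) : ℤ) * -(2 * p - 1) ^ n +
      (2 * p - 1) ^ (n + 1)) = (2 * p - 1) ^ n
    rw [h1]
    ring

theorem iterate_eq_of_two_le {α : Type*} (f : α → α) {n : ℕ} (hn : 2 ≤ n) {x z : α}
    (hx : f (f x) = z) (hz : f z = z) : f^[n] x = z := by
  obtain ⟨q, rfl⟩ := Nat.exists_eq_add_of_le' hn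
  rw [Function.iterate_add_apply]
  change f^[q] (f (f x)) = z
  rw [hx]
  exact Function.iterate_fixed hz q

theorem derToEnd_pd_pow [hp : Fact p.Prime] (y : WildSpecie k) :
    derToEnd (pd p K y) ^ p = 0 := by
  have h : derPMap p (pd p K y) = 0 := by
    apply der_ext
    intro z
    have h1 : pd p K y (pd p K y (t p K z)) = 0 := by
      rw [pd, mkDer_t]
      split_ifs
      · exact Derivation.map_one_eq_zero _
      · exact map_zero _
    rw [derPMap_apply, Derivation.zero_apply]
    exact iterate_eq_of_two_le (pd p K y) hp.out.two_le h1 (map_zero _)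
  have h2 := derToEnd_derPMap 1 (pd p K y)
  rw [pow_one, Function.iterate_one, h, map_zero] at h2
  exact h2.symm

theorem card_low (k m : ℕ) :
    Fintype.card (Low k m) = ∑ i ∈ Finset.range m, Fintype.card (WildFly k i) := by
  rw [Fintype.card_sigma, Fin.sum_univ_eq_sum_range fun i => Fintype.card (WildFly k i)]

theorem wildGrowth_eq (p k : ℕ) [Fact p.Prime] (K : Type*) [Field K] [CharP K p] (n : ℕ) :
    wildGrowth p k K n = Module.finrank K (derGrowth p (wildGens p k K) n) :=
  growthFunction_eq_finrank _ _

theorem finite_derGrowth_and_wildGrowth_le [hp : Fact p.Prime] (hk : 3 ≤ k) (m n : ℕ) :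
    Module.Finite K (derGrowth p (wildGens p k K) n) ∧ wildGrowth p k K n ≤
      p ^ (2 * ∑ i ∈ Finset.range m, Fintype.card (WildFly k i)) * Fintype.card (WildFly k m) ^
        (n / (2 * p - 1) ^ m + p * (∑ i ∈ Finset.range m, Fintype.card (WildFly k i)) + 1) := by
  have h2 := hp.out.two_le
  have h2' : (1 : ℤ) ≤ 2 * p - 1 := by
    have : (2 : ℤ) ≤ p := by exact_mod_cast h2
    linarith
  rw [wildGrowth_eq, ← card_low]
  refine derGrowth_le (S := operatorSystem (k := k) p K m)
    (wt := fun y => genWeight p k y.toSpecie) (W := (2 * p - 1) ^ m) ?_ (fun i => t_pow_p _)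
    (fun i => derToEnd_pd_pow _) (fun i => (genWeight_pos p k _).le) (fun i => ?_) (by positivity)
    (by have := three_le_card hk m; omega) ?_
  · rintro _ ⟨i, rfl⟩
    have := pivot_mem_raising (p := p) (K := K) m m (zero_add m) (show WildFly k 0 from i)
    rwa [pow_zero] at this
  · exact pow_le_pow_right₀ h2' i.1.2.le
  · have h3 : (((2 * p - 1) ^ m : ℕ) : ℤ) = (2 * (p : ℤ) - 1) ^ m := by
      rw [Nat.cast_pow, Nat.cast_sub (by omega)]
      simp
    have hW : 0 < (2 * p - 1) ^ m := pow_pos (by omega) m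
    have h4 : n < (n / (2 * p - 1) ^ m + 1) * (2 * p - 1) ^ m := by
      rw [mul_comm]
      exact Nat.lt_mul_div_succ n hW
    rw [← h3]
    push_cast [-Nat.cast_pow]
    have h5 : (n : ℤ) < ((n / (2 * p - 1) ^ m + 1 : ℕ) : ℤ) * ((2 * p - 1) ^ m : ℕ) := by
      exact_mod_cast h4
    refine h5.trans_eq ?_
    push_cast
    ring

theorem choose_le_wildGrowth [hp : Fact p.Prime] (hk : 3 ≤ k) {m n N : ℕ} (hn : 1 ≤ n)
    (hc : 2 * n ≤ Fintype.card (WildFly k m)) (hN : n * (2 * p - 1) ^ m ≤ N) :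
    (Fintype.card (WildFly k m)).choose n ≤ wildGrowth p k K N := by
  obtain ⟨F, hF, hli⟩ := exists_linearIndependent (p := p) (K := K) hk m n hn hc
  -- Any cutoff would do; generation 0 is used only for finiteness.
  have := (finite_derGrowth_and_wildGrowth_le (p := p) (K := K) hk 0 N).1
  rw [wildGrowth_eq, ← Fintype.card_finset_len]
  exact card_le_finrank_derGrowth hN hF hli

end WildFly

end

noncomputable section

/-! ## The asymptotics of the growth function -/

namespace WildFly

theorem card_zero (k : ℕ) : Fintype.card (WildFly k 0) = k := Fintype.card_fin k

theorem card_le_pow (k m : ℕ) : Fintype.card (WildFly k m) ≤ k ^ 2 ^ m := by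
  induction m with
  | zero => rw [card_zero, pow_zero, pow_one]
  | succ m ih =>
    rw [card_succ, pow_succ, pow_mul, sq]
    exact Nat.mul_le_mul ih ((Nat.sub_le _ _).trans ih)

/-- Strictness carries the induction: it absorbs the -1 in q(q - 1). -/
theorem pow_lt_card {k : ℕ} (hk : 3 ≤ k) (m : ℕ) : 2 ^ 2 ^ m < Fintype.card (WildFly k m) := by
  induction m with
  | zero => rw [card_zero, pow_zero, pow_one]; omega
  | succ m ih =>
    rw [card_succ, pow_succ, pow_mul, sq]
    have h : 2 ^ 2 ^ m ≤ Fintype.card (WildFly k m) - 1 := by omega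
    calc 2 ^ 2 ^ m * 2 ^ 2 ^ m < Fintype.card (WildFly k m) * 2 ^ 2 ^ m :=
          Nat.mul_lt_mul_of_pos_right ih (by positivity)
      _ ≤ _ := Nat.mul_le_mul_left _ h

theorem le_card {k : ℕ} (hk : 3 ≤ k) (m : ℕ) : m ≤ Fintype.card (WildFly k m) :=
  (Nat.lt_two_pow_self.le.trans Nat.lt_two_pow_self.le).trans (pow_lt_card hk m).le

theorem sum_card_le {k : ℕ} (hk : 3 ≤ k) (m : ℕ) :
    ∑ i ∈ Finset.range (m + 1), Fintype.card (WildFly k i) ≤ 2 * Fintype.card (WildFly k m) := by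
  induction m with
  | zero => rw [Finset.sum_range_one]; omega
  | succ m ih =>
    rw [Finset.sum_range_succ, card_succ k m]
    have h := three_le_card hk m
    have : Fintype.card (WildFly k m) * 2 ≤
        Fintype.card (WildFly k m) * (Fintype.card (WildFly k m) - 1) :=
      Nat.mul_le_mul_left _ (by omega)
    omega

/-- C(q, n) ≥ (q+1-n)^n / n!, with q+1-n ≥ N n and n! ≤ n^n. -/
theorem pow_le_choose {N n q : ℕ} (hn : n ≤ N) (hq : 2 * N ^ 2 ≤ q) : N ^ n ≤ q.choose n := by
  have h1 : (((q + 1 - n : ℕ) : ℚ) ^ n) / n.factorial ≤ q.choose n := Nat.pow_le_choose n q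
  have h2 : N * n ≤ q + 1 - n := by
    have : N * n ≤ N ^ 2 := by rw [sq]; exact Nat.mul_le_mul_left _ hn
    have h3 : n ≤ N ^ 2 + 1 := by nlinarith
    omega
  have h4 : N ^ n * n.factorial ≤ (q + 1 - n) ^ n :=
    calc N ^ n * n.factorial ≤ N ^ n * n ^ n := Nat.mul_le_mul_left _ (Nat.factorial_le_pow n)
      _ = (N * n) ^ n := (mul_pow _ _ _).symm
      _ ≤ _ := Nat.pow_le_pow_left h2 n
  have h5 : (0 : ℚ) < n.factorial := by exact_mod_cast n.factorial_pos
  rw [div_le_iff₀ h5] at h1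
  have h6 : N ^ n * n.factorial ≤ q.choose n * n.factorial := h4.trans (by exact_mod_cast h1)
  exact Nat.le_of_mul_le_mul_right h6 n.factorial_pos

/-- The exponent λ + 1 is log_2(2p - 1); this converts 2^m into the degree of a pivot of generation
m. -/
theorem rpow_logb_two (p m : ℕ) (hp : 2 ≤ p) :
    ((2 : ℝ) ^ m) ^ (Real.logb 2 ((p : ℝ) - 1 / 2) + 1) = ((2 * p - 1 : ℕ) : ℝ) ^ m := by
  have h : (2 : ℝ) ≤ p := by exact_mod_cast hp
  have h1 : (2 : ℝ) ^ (Real.logb 2 ((p : ℝ) - 1 / 2) + 1) = ((2 * p - 1 : ℕ) : ℝ) := by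
    rw [Real.rpow_add two_pos, Real.rpow_logb two_pos (by norm_num) (by linarith), Real.rpow_one,
      Nat.cast_sub (by omega)]
    push_cast
    ring
  rw [← h1, ← Real.rpow_natCast 2 m, ← Real.rpow_mul two_pos.le, mul_comm, Real.rpow_mul two_pos.le,
    Real.rpow_natCast]

theorem logb_pos (p : ℕ) (hp : 2 ≤ p) : 0 < Real.logb 2 ((p : ℝ) - 1 / 2) := by
  have h : (2 : ℝ) ≤ p := by exact_mod_cast hp
  exact Real.logb_pos (by norm_num) (by linarith)

theorem eventually_mul_log_rpow_le (c μ r : ℝ) (hr : 0 < r) :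
    ∀ᶠ n : ℕ in Filter.atTop, c * Real.log n ^ μ ≤ (n : ℝ) ^ r := by
  have h := ((isLittleO_log_rpow_rpow_atTop μ hr).const_mul_left c).eventuallyLE
  have h' := tendsto_natCast_atTop_atTop (R := ℝ) |>.eventually h
  filter_upwards [h'] with n hn
  refine (le_abs_self _).trans (hn.trans_eq ?_)
  exact Real.norm_of_nonneg (Real.rpow_nonneg (Nat.cast_nonneg n) r)

theorem exp_le_wildGrowth {p k : ℕ} [hp : Fact p.Prime] (hk : 3 ≤ k) :
    ∃ n₀ : ℕ, ∀ (K : Type*) [Field K] [CharP K p] (N : ℕ), n₀ ≤ N →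
      Real.exp (1 / (2 * 12 ^ (Real.logb 2 ((p : ℝ) - 1 / 2) + 1)) *
        ((N : ℝ) / Real.log N ^ Real.logb 2 ((p : ℝ) - 1 / 2))) ≤ (wildGrowth p k K N : ℝ) := by
  have h2 := hp.out.two_le
  set l := Real.logb 2 ((p : ℝ) - 1 / 2) with hl
  have hl0 : 0 < l := logb_pos p h2
  obtain ⟨n₀, hn₀⟩ := Filter.eventually_atTop.mp
    (eventually_mul_log_rpow_le (12 ^ (l + 1)) (l + 1) 1 one_pos)
  refine ⟨max n₀ (k + 3), fun K _ _ N hN => ?_⟩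
  have hNk : k + 3 ≤ N := (le_max_right _ _).trans hN
  have hN1 : (1 : ℝ) < N := by exact_mod_cast (by omega : 1 < N)
  have hlog : 0 < Real.log N := Real.log_pos hN1
  -- The first generation with 2N^2 flies. The generation before it has fewer than N^3, which bounds
  -- 2^m by 12 ln N: 2^j · ln 2 ≤ 3 ln N, ln 2 ≥ 1/2 and m = j + 1.
  have hex : ∃ m, 2 * N ^ 2 ≤ Fintype.card (WildFly k m) := ⟨2 * N ^ 2, le_card hk _⟩
  classical
  obtain ⟨hm, hmin⟩ := And.intro (Nat.find_spec hex) (fun j => Nat.find_min hex (m := j))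
  generalize Nat.find hex = m at hm hmin
  obtain ⟨j, rfl⟩ : ∃ j, m = j + 1 := by
    refine Nat.exists_eq_succ_of_ne_zero ?_
    rintro rfl
    rw [card_zero] at hm
    nlinarith
  have hj : Fintype.card (WildFly k j) < N ^ 3 := by
    have := hmin j (Nat.lt_succ_self j)
    have h3 : 2 * N ^ 2 ≤ N ^ 3 := by
      rw [pow_succ N 2, mul_comm]
      exact Nat.mul_le_mul_left _ (by omega)
    omega
  have hpow : (2 : ℝ) ^ (j + 1) ≤ 12 * Real.log N := by
    have h3 : (2 : ℝ) ^ 2 ^ j ≤ (N : ℝ) ^ 3 := by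
      exact_mod_cast ((pow_lt_card hk j).trans hj).le
    have h4 := Real.log_le_log (by positivity) h3
    rw [Real.log_pow, Real.log_pow] at h4
    push_cast at h4
    have h5 : (1 / 2 : ℝ) ≤ Real.log 2 := by linarith [Real.log_two_gt_d9]
    have h6 : (2 : ℝ) ^ j * (1 / 2) ≤ 2 ^ j * Real.log 2 := by gcongr
    rw [pow_succ]
    linarith
  set W : ℕ := (2 * p - 1) ^ (j + 1) with hW
  have hWpos : 0 < W := pow_pos (by omega) _
  have hWle : (W : ℝ) ≤ 12 ^ (l + 1) * Real.log N ^ (l + 1) := by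
    rw [hW, Nat.cast_pow, ← rpow_logb_two p (j + 1) h2, ← Real.mul_rpow (by norm_num) hlog.le]
    exact Real.rpow_le_rpow (by positivity) hpow (by linarith)
  have hWN : W ≤ N := by
    have := hWle.trans (hn₀ N ((le_max_left _ _).trans hN))
    rw [Real.rpow_one] at this
    exact_mod_cast this
  have hn1 : 1 ≤ N / W := (Nat.one_le_div_iff hWpos).mpr hWN
  have hnN : N / W ≤ N := Nat.div_le_self _ _
  have hge := choose_le_wildGrowth (p := p) (K := K) hk (m := j + 1) (N := N) hn1
    (by nlinarith) (Nat.div_mul_le_self N W)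
  have hge' : ((N : ℝ)) ^ (N / W) ≤ wildGrowth p k K N := by
    exact_mod_cast (pow_le_choose hnN hm).trans hge
  refine le_trans ?_ hge'
  rw [← Real.exp_log (pow_pos (by linarith : (0 : ℝ) < N) (N / W)), Real.log_pow,
    Real.exp_le_exp]
  -- Since N/W ≥ 1, taking the integer part loses at most a factor 2.
  have hfloor : (N : ℝ) / (2 * W) ≤ ((N / W : ℕ) : ℝ) := by
    rw [div_le_iff₀ (by positivity)]
    have h3 : N < (N / W + 1) * W := by
      rw [mul_comm]; exact Nat.lt_mul_div_succ N hWpos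
    have h4 : N ≤ N / W * (2 * W) := by nlinarith
    exact_mod_cast h4
  have hsplit : Real.log N ^ (l + 1) = Real.log N ^ l * Real.log N := by
    rw [Real.rpow_add hlog, Real.rpow_one]
  calc 1 / (2 * 12 ^ (l + 1)) * ((N : ℝ) / Real.log N ^ l)
      = (N : ℝ) / (2 * (12 ^ (l + 1) * Real.log N ^ (l + 1))) * Real.log N := by
        rw [hsplit]; field_simp
    _ ≤ (N : ℝ) / (2 * W) * Real.log N := by gcongr
    _ ≤ _ := by gcongr

theorem wildGrowth_le_exp {p k : ℕ} [hp : Fact p.Prime] (hk : 3 ≤ k) :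
    ∃ n₀ : ℕ, ∀ (K : Type*) [Field K] [CharP K p] (N : ℕ), n₀ ≤ N →
      (wildGrowth p k K N : ℝ) ≤
        Real.exp (((2 * Real.log k) ^ (Real.logb 2 ((p : ℝ) - 1 / 2) + 1) + 1) *
          ((N : ℝ) / Real.log N ^ Real.logb 2 ((p : ℝ) - 1 / 2))) := by
  have h2 := hp.out.two_le
  set l := Real.logb 2 ((p : ℝ) - 1 / 2) with hl
  have hl0 : 0 < l := logb_pos p h2
  have hk1 : (1 : ℝ) < k := by exact_mod_cast (by omega : 1 < k)
  have hlogk : 0 < Real.log k := Real.log_pos hk1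
  have hlogp : 0 ≤ Real.log p := Real.log_natCast_nonneg p
  -- The constant collects the lower-order terms: with s ≤ 2r low flies, r = √N, p^(2s) gives 4 ln
  -- p, while the exponents p s and 1 of c give 2p and 1.
  obtain ⟨n₀, hn₀⟩ := Filter.eventually_atTop.mp
    (eventually_mul_log_rpow_le (4 * Real.log p + 2 * p + 1) (l + 1) (1 / 2) (by norm_num))
  refine ⟨max n₀ (k ^ 2), fun K _ _ N hN => ?_⟩
  have hNk : k ^ 2 ≤ N := (le_max_right _ _).trans hN
  have hN9 : 9 ≤ N := le_trans (by nlinarith) hNk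
  have hN0 : (0 : ℝ) < N := by exact_mod_cast (by omega : 0 < N)
  have hlog1 : 1 ≤ Real.log N := by
    rw [Real.le_log_iff_exp_le hN0]
    have : (9 : ℝ) ≤ N := by exact_mod_cast hN9
    linarith [Real.exp_one_lt_d9]
  have hlog : 0 < Real.log N := by linarith
  -- The first generation with more than √N flies: the one before has at most √N, so this one still
  -- has at most N.
  have hex : ∃ m, N < Fintype.card (WildFly k m) ^ 2 :=
    ⟨N + 1, lt_of_lt_of_le (by nlinarith) (Nat.pow_le_pow_left (le_card hk (N + 1)) 2)⟩
  classical
  obtain ⟨hm, hmin⟩ := And.intro (Nat.find_spec hex) (fun j => Nat.find_min hex (m := j))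
  generalize Nat.find hex = m at hm hmin
  obtain ⟨j, rfl⟩ : ∃ j, m = j + 1 := by
    refine Nat.exists_eq_succ_of_ne_zero ?_
    rintro rfl
    rw [card_zero] at hm
    omega
  have hj : Fintype.card (WildFly k j) ^ 2 ≤ N := not_lt.mp (hmin j (Nat.lt_succ_self j))
  set c := Fintype.card (WildFly k (j + 1)) with hc
  have hcN : c ≤ N := by
    refine le_trans ?_ hj
    rw [hc, card_succ, sq]
    exact Nat.mul_le_mul_left _ (Nat.sub_le _ _)
  have hc3 : 3 ≤ c := three_le_card hk (j + 1)
  have hc0 : (0 : ℝ) < c := by exact_mod_cast (by omega : 0 < c)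
  have hlogc : Real.log c ≤ Real.log N := Real.log_le_log hc0 (by exact_mod_cast hcN)
  have hlogc0 : 0 ≤ Real.log c := Real.log_natCast_nonneg c
  set r : ℝ := (N : ℝ) ^ (1 / 2 : ℝ) with hr
  have hrr : r * r = N := by
    rw [hr, ← Real.rpow_add hN0]; norm_num
  have hr0 : 0 < r := Real.rpow_pos_of_pos hN0 _
  have hr1 : 1 ≤ r := by
    have : (9 : ℝ) ≤ N := by exact_mod_cast hN9
    nlinarith
  set s := ∑ i ∈ Finset.range (j + 1), Fintype.card (WildFly k i) with hs
  have hsr : (s : ℝ) ≤ 2 * r := by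
    have h3 : (s : ℝ) ≤ 2 * (Fintype.card (WildFly k j) : ℝ) := by
      exact_mod_cast sum_card_le hk j
    have h4 : (Fintype.card (WildFly k j) : ℝ) ^ 2 ≤ r ^ 2 := by
      rw [sq r, hrr]; exact_mod_cast hj
    linarith [le_of_sq_le_sq h4 hr0.le]
  have hpow : Real.log N / (2 * Real.log k) ≤ (2 : ℝ) ^ (j + 1) := by
    have h3 : (N : ℝ) ≤ (k : ℝ) ^ (2 ^ (j + 1) * 2) := by
      rw [pow_mul]
      exact_mod_cast hm.le.trans (Nat.pow_le_pow_left (card_le_pow k (j + 1)) 2)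
    have h4 := Real.log_le_log hN0 h3
    rw [Real.log_pow] at h4
    push_cast at h4
    rw [div_le_iff₀ (by positivity)]
    linarith
  set W : ℕ := (2 * p - 1) ^ (j + 1) with hW
  have hWpos : 0 < W := pow_pos (by omega) _
  have hWge : Real.log N ^ (l + 1) / (2 * Real.log k) ^ (l + 1) ≤ W := by
    rw [hW, Nat.cast_pow, ← rpow_logb_two p (j + 1) h2, ← Real.div_rpow hlog.le (by positivity)]
    exact Real.rpow_le_rpow (by positivity) hpow (by linarith)
  have hub : (wildGrowth p k K N : ℝ) ≤ (p : ℝ) ^ (2 * s) * (c : ℝ) ^ (N / W + p * s + 1) := by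
    exact_mod_cast (finite_derGrowth_and_wildGrowth_le (p := p) (K := K) hk (j + 1) N).2
  refine hub.trans ?_
  have hp0 : (0 : ℝ) < p := by exact_mod_cast (by omega : 0 < p)
  rw [← Real.exp_log (mul_pos (pow_pos hp0 (2 * s)) (pow_pos hc0 (N / W + p * s + 1))),
    Real.exp_le_exp, Real.log_mul (by positivity) (by positivity), Real.log_pow, Real.log_pow]
  push_cast
  have hsplit : Real.log N ^ (l + 1) = Real.log N ^ l * Real.log N := by
    rw [Real.rpow_add hlog, Real.rpow_one]
  have hlpos : 0 < Real.log N ^ l := Real.rpow_pos_of_pos hlog _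
  have hmain : ((N / W : ℕ) : ℝ) * Real.log N ≤
      (2 * Real.log k) ^ (l + 1) * ((N : ℝ) / Real.log N ^ l) := by
    have hW0 : (0 : ℝ) < W := by exact_mod_cast hWpos
    have hkpos : 0 < (2 * Real.log k) ^ (l + 1) := Real.rpow_pos_of_pos (by positivity) _
    have h3 : ((N / W : ℕ) : ℝ) ≤ N / W := Nat.cast_div_le
    have h4 : (N : ℝ) / W ≤ N / (Real.log N ^ (l + 1) / (2 * Real.log k) ^ (l + 1)) := by
      gcongr
    calc ((N / W : ℕ) : ℝ) * Real.log N
        ≤ N / (Real.log N ^ (l + 1) / (2 * Real.log k) ^ (l + 1)) * Real.log N := by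
          gcongr; exact h3.trans h4
      _ = _ := by rw [hsplit]; field_simp
  -- The low flies cost only √N ln N, below the main order; this is the summand 1 of the final
  -- constant.
  have hrest : (4 * Real.log p + 2 * p + 1) * r * Real.log N ≤ (N : ℝ) / Real.log N ^ l := by
    have h3 := hn₀ N ((le_max_left _ _).trans hN)
    rw [le_div_iff₀ hlpos]
    calc (4 * Real.log p + 2 * p + 1) * r * Real.log N * Real.log N ^ l
        = ((4 * Real.log p + 2 * p + 1) * Real.log N ^ (l + 1)) * r := by rw [hsplit]; ring
      _ ≤ r * r := by gcongr
      _ = N := hrr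
  have h3 : 2 * (s : ℝ) * Real.log p ≤ 4 * Real.log p * r * Real.log N := by
    have h4 : 2 * (s : ℝ) * Real.log p ≤ 2 * (2 * r) * Real.log p := by gcongr
    have h5 : 4 * Real.log p * r * 1 ≤ 4 * Real.log p * r * Real.log N := by gcongr
    linarith
  have h6 : ((N / W : ℕ) + (p : ℝ) * s + 1) * Real.log c ≤
      ((N / W : ℕ) : ℝ) * Real.log N + (2 * p + 1) * r * Real.log N := by
    calc ((N / W : ℕ) + (p : ℝ) * s + 1) * Real.log c
        ≤ ((N / W : ℕ) + (p : ℝ) * (2 * r) + r) * Real.log N := by gcongr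
      _ = _ := by ring
  calc 2 * (s : ℝ) * Real.log p + (((N / W : ℕ) : ℝ) + p * s + 1) * Real.log c
      ≤ 4 * Real.log p * r * Real.log N + (((N / W : ℕ) : ℝ) * Real.log N +
        (2 * p + 1) * r * Real.log N) := add_le_add h3 h6
    _ = ((N / W : ℕ) : ℝ) * Real.log N + (4 * Real.log p + 2 * p + 1) * r * Real.log N := by ring
    _ ≤ _ := (add_le_add hmain hrest).trans_eq (by ring)

end WildFly

end

/-! ### The two-sided bound. -/

theorem theorem8p1 (p k : ℕ) [Fact p.Prime] (hk : 3 ≤ k) :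
    ∃ C₃ C₄ : ℝ, 0 < C₃ ∧ 0 < C₄ ∧
      ∀ (K : Type*) [Field K] [CharP K p], ∃ n₀ : ℕ, ∀ n : ℕ, n₀ ≤ n →
        Real.exp (C₃ * ((n : ℝ) / Real.log n ^ Real.logb 2 ((p : ℝ) - 1 / 2)))
            ≤ (wildGrowth p k K n : ℝ) ∧
          (wildGrowth p k K n : ℝ)
            ≤ Real.exp (C₄ * ((n : ℝ) / Real.log n ^ Real.logb 2 ((p : ℝ) - 1 / 2))) := by
  have hlog : 0 ≤ Real.log k := Real.log_natCast_nonneg k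
  refine ⟨1 / (2 * 12 ^ (Real.logb 2 ((p : ℝ) - 1 / 2) + 1)),
    (2 * Real.log k) ^ (Real.logb 2 ((p : ℝ) - 1 / 2) + 1) + 1,
    by positivity, by positivity, fun K _ _ => ?_⟩
  obtain ⟨n₁, h₁⟩ := WildFly.exp_le_wildGrowth (p := p) hk
  obtain ⟨n₂, h₂⟩ := WildFly.wildGrowth_le_exp (p := p) hk
  exact ⟨max n₁ n₂, fun n hn => ⟨h₁ K n ((le_max_left _ _).trans hn),
    h₂ K n ((le_max_right _ _).trans hn)⟩⟩
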